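/- Let $M$ be a first-order structure in a language $L$, let $\bar M \succeq M$ be a monster model, i.e. $\bar M$ is $\kappa$-saturated and strongly $\kappa$-homogeneous for some uncountable strong limit cardinal $\kappa>|L|$, and let $A\subseteq M$ with $|A|<\kappa$. For a set $D$ definable in $M$ write $\bar D$ for its interpretation in $\bar M$. Let $R$ be a commutative unital ring that is $\emptyset$-definable in $M$ and is generated, as a unital ring, by a set of $n$ elements which lie in $A$ (if $R$ consists of tuples of elements of $M$: whose coordinates lie in $A$). A subset $D$ of $(R,+)$ is called thick if $D=-D$ and there is $m>0$ such that for all $g_0,\dots,g_{m-1}\in R$ there are $i<j<m$ with $g_j-g_i\in D$. For a subset $Y$ of an abelian group, $Y^{+m}$ is the $m$-fold sum $Y+\dots+Y$ ($Y^{+0}=\{0\}$). For a subset $D$ of $R$ let $D_\leftarrow=(R\cup\{1\})\cdot D$, $D_\rightarrow=D\cdot(R\cup\{1\})$, $D_\leftrightarrow=(R\cup\{1\})\cdot D\cdot(R\cup\{1\})$ be the sets of products, and similarly for subsets of $\bar R$. Let $(\bar R,+)^0_A$ [resp. $\bar R^0_A$] be the intersection of all $A$-definable subgroups [ideals] of finite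 index of $(\bar R,+)$ [of $\bar R$], let $(\bar R,+)^{00}_A$ [resp. $\bar R^{00}_A$] be the smallest $A$-type-definable subgroup [ideal] of index less than $\kappa$, and let $\bar R^{000}_A$ be the smallest ideal of $\bar R$ that is invariant under $\mathrm{Aut}(\bar M/A)$ and has index less than $\kappa$. Put $X=(\bar R,+)^{00}_A$ and $X'=(\bar R,+)^0_A$. For $i\in\{\leftarrow,\rightarrow,\leftrightarrow\}$ and $m\ge 0$ consider the conditions: - (i)$_m$: the subgroup $J$ of $(\bar R,+)$ generated by $X_i$ is equal to $X_i^{+m}$, and $\bar R^{000}_A=X_i^{+m}=\bar R^{00}_A$; - (ii)$_m$: for every $A$-definable $D\subseteq R$ with $(\bar R,+)^{00}_A\subseteq\bar D$, the set $D_i^{+m}$ contains an $A$-definable ideal of $R$ of finite index; - (iii)$_m$: for every $A$-definable subgroup $H$ of $(R,+)$ of finite index, $H_i^{+m}$ contains an $A$-definable ideal of $R$ of finite index; - (iv)$_m$: the subgroup $J'_i$ of $(\bar R,+)$ generated by $X'_i$ is equal to $(X'_i)^{+m}$; - (v)$_m$: $(X'_i)^{+m}=\bar R^0_A$. Then: 1.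 For every (not necessarily definable) thick subset $D$ of $(R,+)$, the set $(R\cdot D)^{+(n+1)}$ contains an $A$-definable ideal of $R$ of finite index. Moreover, all the conditions (i)$_{n+1}$--(v)$_{n+1}$ hold, for each $i\in\{\leftarrow,\rightarrow,\leftrightarrow\}$. 2. If $R$ is additionally of positive characteristic, then the same holds with $n$ in place of $n+1$: for every thick subset $D$ of $(R,+)$, the set $(R\cdot D)^{+n}$ contains an $A$-definable ideal of $R$ of finite index, and all the conditions (i)$_n$--(v)$_n$ hold, for each $i$. -/

import Mathlib

open FirstOrder Cardinal

universe u v w w'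

namespace ModelRing

section Interpretation

variable {L : FirstOrder.Language.{u, v}} {M : Type w} {N : Type w'} [L.Structure M] [L.Structure N]

/-- The interpretation in `N` of a set `D` definable (with parameters) in `M`, along an
elementary embedding `f : M → N`: the set defined in `N` by a formula over `M` defining `D`.
By elementarity the choice of the formula does not matter, see `interp_eq`. -/
def interp (f : M ↪ₑ[L] N) {ι : Type} (D : Set (ι → M)) : Set (ι → N) :=
  {y | ∃ φ : L.Formula (M ⊕ ι), D = {x | φ.Realize (Sum.elim id x)} ∧
    φ.Realize (Sum.elim f y)}

theorem transfer (f : M ↪ₑ[L] N) {ι : Type} [Finite ι] (φ : L.Formula (M ⊕ ι)) :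
    (∀ x : ι → M, φ.Realize (Sum.elim id x)) ↔ ∀ y : ι → N, φ.Realize (Sum.elim f y) := by
  rw [← FirstOrder.Language.Formula.realize_iAlls, ← f.map_formula, FirstOrder.Language.Formula.realize_iAlls]
  rfl

theorem interp_eq (f : M ↪ₑ[L] N) {ι : Type} [Finite ι] (φ : L.Formula (M ⊕ ι)) :
    interp f {x : ι → M | φ.Realize (Sum.elim id x)} = {y | φ.Realize (Sum.elim f y)} := by
  ext y
  constructor
  · rintro ⟨ψ, hψ, hy⟩
    have h := (transfer f (ψ.imp φ)).1 (by
      intro x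
      rw [FirstOrder.Language.Formula.realize_imp]
      intro hx
      have : x ∈ {x : ι → M | ψ.Realize (Sum.elim id x)} := hx
      rw [← hψ] at this
      exact this) y
    rw [FirstOrder.Language.Formula.realize_imp] at h
    exact h hy
  · intro hy
    exact ⟨φ, rfl, hy⟩

theorem exists_formula (f : M ↪ₑ[L] N) {ι : Type} [Finite ι] {D : Set (ι → M)}
    (hD : (∅ : Set M).Definable L D) : ∃ φ : L.Formula ι,
      (∀ x, x ∈ D ↔ φ.Realize x) ∧ ∀ y, y ∈ interp f D ↔ φ.Realize y := by
  obtain ⟨φ, rfl⟩ := Set.empty_definable_iff.1 hD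
  refine ⟨φ, fun x => Iff.rfl, fun y => ?_⟩
  have h := interp_eq f (φ.relabel (Sum.inr : ι → M ⊕ ι))
  simp only [FirstOrder.Language.Formula.realize_relabel, Sum.elim_comp_inr] at h
  exact Set.ext_iff.1 h y

end Interpretation

/-- The concatenation of three `k`-tuples. -/
def cat3 {V : Type*} {k : ℕ} (a b c : Fin k → V) : Fin 3 × Fin k → V :=
  fun p => ![a, b, c] p.1 p.2

/-- A commutative unital ring that is definable in `M` without parameters: its universe is a
`∅`-definable set of `k`-tuples, and the graphs of its addition and multiplication are
`∅`-definable. -/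
structure DefinableCommRing (L : FirstOrder.Language.{u, v}) (M : Type w) [L.Structure M] (k : ℕ) where
  carrier : Set (Fin k → M)
  ring : CommRing carrier
  definable_carrier : (∅ : Set M).Definable L carrier
  definable_add : (∅ : Set M).Definable L
    {x : Fin 3 × Fin k → M | ∃ a b : carrier, x = cat3 a.1 b.1 (a + b).1}
  definable_mul : (∅ : Set M).Definable L
    {x : Fin 3 × Fin k → M | ∃ a b : carrier, x = cat3 a.1 b.1 (a * b).1}

attribute [instance] DefinableCommRing.ring

namespace DefinableCommRing

variable {L : FirstOrder.Language.{u, v}} {M : Type w} {N : Type w'} [L.Structure M] [L.Structure N] {k : ℕ}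

/-- The graph of addition. -/
def addGraph (R : DefinableCommRing L M k) : Set (Fin 3 × Fin k → M) :=
  {x | ∃ a b : R.carrier, x = cat3 a.1 b.1 (a + b).1}

/-- The graph of multiplication. -/
def mulGraph (R : DefinableCommRing L M k) : Set (Fin 3 × Fin k → M) :=
  {x | ∃ a b : R.carrier, x = cat3 a.1 b.1 (a * b).1}

/-- The interpretation of the definable ring `R` in `N`; its ring operations are
those whose graphs are the interpretations of the graphs of the operations of `R`. -/
abbrev Bar (R : DefinableCommRing L M k) (f : M ↪ₑ[L] N) : Type w' := ↥(interp f R.carrier)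

section Transfer

/-- Substitution of three tuples of variables into a formula in three tuples of variables. -/
def at3 {V : Type*} (φ : L.Formula (Fin 3 × Fin k)) (a b c : Fin k → V) : L.Formula V :=
  φ.relabel (cat3 a b c)

theorem comp_cat3 {V W : Type*} (g : V → W) (a b c : Fin k → V) :
    g ∘ cat3 a b c = cat3 (g ∘ a) (g ∘ b) (g ∘ c) := by
  funext ⟨i, j⟩
  fin_cases i <;> rfl

theorem realize_at3 {V : Type*} {P : Type*} [L.Structure P] (φ : L.Formula (Fin 3 × Fin k))
    (a b c : Fin k → V) (g : V → P) :
    (at3 φ a b c).Realize g ↔ φ.Realize (cat3 (g ∘ a) (g ∘ b) (g ∘ c)) := by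
  rw [at3, FirstOrder.Language.Formula.realize_relabel, comp_cat3]

theorem cat3_inj {V : Type*} {a b c a' b' c' : Fin k → V} (h : cat3 a b c = cat3 a' b' c') :
    a = a' ∧ b = b' ∧ c = c' :=
  ⟨funext fun j => congrFun h (0, j), funext fun j => congrFun h (1, j),
    funext fun j => congrFun h (2, j)⟩

/-- The graph of a binary operation on a set of tuples. -/
def graph {C : Set (Fin k → M)} (o : C → C → C) : Set (Fin 3 × Fin k → M) :=
  {x | ∃ a b : C, x = cat3 a.1 b.1 (o a b).1}

theorem cat3_mem_graph {C : Set (Fin k → M)} {o : C → C → C} {a b c : Fin k → M} :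
    cat3 a b c ∈ graph o ↔ ∃ (ha : a ∈ C) (hb : b ∈ C), (o ⟨a, ha⟩ ⟨b, hb⟩).1 = c := by
  constructor
  · rintro ⟨x, y, h⟩
    obtain ⟨rfl, rfl, rfl⟩ := cat3_inj h
    exact ⟨x.2, y.2, rfl⟩
  · rintro ⟨ha, hb, rfl⟩
    exact ⟨⟨a, ha⟩, ⟨b, hb⟩, rfl⟩

/-- The `i`-th tuple of variables. -/
def tv {m : ℕ} (i : Fin m) : Fin k → M ⊕ (Fin m × Fin k) := fun j => Sum.inr (i, j)

/-- A tuple of parameters. -/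
def pv {m : ℕ} (c : Fin k → M) : Fin k → M ⊕ (Fin m × Fin k) := fun j => Sum.inl (c j)

theorem elim_tv {m : ℕ} (i : Fin m) {P : Type*} (g : M → P) (x : Fin m × Fin k → P) :
    Sum.elim g x ∘ tv i = fun j => x (i, j) := rfl

theorem elim_pv {m : ℕ} (c : Fin k → M) {P : Type*} (g : M → P) (x : Fin m × Fin k → P) :
    Sum.elim g x ∘ pv c = g ∘ c := rfl

theorem comp_mem (f : M ↪ₑ[L] N) {C : Set (Fin k → M)} (hC : (∅ : Set M).Definable L C)
    (c : C) : f ∘ c.1 ∈ interp f C := by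
  obtain ⟨δ, hδ, hδ'⟩ := exists_formula f hC
  rw [hδ', f.map_formula, ← hδ]
  exact c.2

theorem bar_dom (f : M ↪ₑ[L] N) {C : Set (Fin k → M)} (hC : (∅ : Set M).Definable L C)
    {o : C → C → C} (ho : (∅ : Set M).Definable L (graph o)) {a b c : Fin k → N}
    (h : cat3 a b c ∈ interp f (graph o)) :
    a ∈ interp f C ∧ b ∈ interp f C ∧ c ∈ interp f C := by
  obtain ⟨δ, hδ, hδ'⟩ := exists_formula f hC
  obtain ⟨α, hα, hα'⟩ := exists_formula f ho
  have key := (transfer f ((at3 α (tv 0) (tv 1) (tv 2)).imp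
    (δ.relabel (tv 0) ⊓ (δ.relabel (tv 1) ⊓ δ.relabel (tv (k := k) (2 : Fin 3)))))).1 (by
      intro x
      simp only [FirstOrder.Language.Formula.realize_imp, FirstOrder.Language.Formula.realize_inf, realize_at3,
        FirstOrder.Language.Formula.realize_relabel, elim_tv, ← hα, ← hδ]
      intro hx
      obtain ⟨h1, h2, h3⟩ := cat3_mem_graph.1 hx
      exact ⟨h1, h2, h3 ▸ Subtype.property _⟩) (cat3 a b c)
  simp only [FirstOrder.Language.Formula.realize_imp, FirstOrder.Language.Formula.realize_inf, realize_at3,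
    FirstOrder.Language.Formula.realize_relabel, elim_tv, ← hα', ← hδ'] at key
  exact key h

theorem bar_total (f : M ↪ₑ[L] N) {C : Set (Fin k → M)} (hC : (∅ : Set M).Definable L C)
    {o : C → C → C} (ho : (∅ : Set M).Definable L (graph o)) {a b : Fin k → N}
    (ha : a ∈ interp f C) (hb : b ∈ interp f C) : ∃ c, cat3 a b c ∈ interp f (graph o) := by
  obtain ⟨δ, hδ, hδ'⟩ := exists_formula f hC
  obtain ⟨α, hα, hα'⟩ := exists_formula f ho
  have key := (transfer f ((δ.relabel (tv (k := k) (0 : Fin 2))).imp ((δ.relabel (tv 1)).imp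
    (FirstOrder.Language.Formula.iExs (Fin k) (at3 α (Sum.inl ∘ tv 0) (Sum.inl ∘ tv 1) Sum.inr))))).1 (by
      intro x
      simp only [FirstOrder.Language.Formula.realize_imp, realize_at3, FirstOrder.Language.Formula.realize_iExs,
        FirstOrder.Language.Formula.realize_relabel, elim_tv, ← hα, ← hδ, ← Function.comp_assoc,
        Sum.elim_comp_inl, Sum.elim_comp_inr]
      intro h1 h2
      exact ⟨_, cat3_mem_graph.2 ⟨h1, h2, rfl⟩⟩) (fun p => ![a, b] p.1 p.2)
  simp only [FirstOrder.Language.Formula.realize_imp, realize_at3, FirstOrder.Language.Formula.realize_iExs,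
        FirstOrder.Language.Formula.realize_relabel, elim_tv, ← hα', ← hδ', ← Function.comp_assoc,
        Sum.elim_comp_inl, Sum.elim_comp_inr] at key
  exact key ha hb

theorem bar_unique (f : M ↪ₑ[L] N) {C : Set (Fin k → M)}
    {o : C → C → C} (ho : (∅ : Set M).Definable L (graph o)) {a b c d : Fin k → N}
    (hc : cat3 a b c ∈ interp f (graph o)) (hd : cat3 a b d ∈ interp f (graph o)) : c = d := by
  obtain ⟨α, hα, hα'⟩ := exists_formula f ho
  funext j
  have key := (transfer f ((at3 α (tv (k := k) (0 : Fin 4)) (tv 1) (tv 2)).imp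
    ((at3 α (tv 0) (tv 1) (tv 3)).imp
      ((FirstOrder.Language.Term.var (tv 2 j)).equal (FirstOrder.Language.Term.var (tv 3 j)))))).1 (by
      intro x
      simp only [FirstOrder.Language.Formula.realize_imp, realize_at3, elim_tv, ← hα,
        FirstOrder.Language.Formula.realize_equal, FirstOrder.Language.Term.realize_var]
      intro h1 h2
      obtain ⟨_, _, h1⟩ := cat3_mem_graph.1 h1
      obtain ⟨_, _, h2⟩ := cat3_mem_graph.1 h2
      exact congrFun (h1.symm.trans h2) j) (fun p => ![a, b, c, d] p.1 p.2)
  simp only [FirstOrder.Language.Formula.realize_imp, realize_at3, elim_tv, ← hα',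
        FirstOrder.Language.Formula.realize_equal, FirstOrder.Language.Term.realize_var] at key
  exact key hc hd

theorem bar_assoc (f : M ↪ₑ[L] N) {C : Set (Fin k → M)}
    {o : C → C → C} (ho : (∅ : Set M).Definable L (graph o))
    (hl : ∀ a b c, o (o a b) c = o a (o b c)) {a b c p q r : Fin k → N}
    (h1 : cat3 a b p ∈ interp f (graph o)) (h2 : cat3 p c r ∈ interp f (graph o))
    (h3 : cat3 b c q ∈ interp f (graph o)) : cat3 a q r ∈ interp f (graph o) := by
  obtain ⟨α, hα, hα'⟩ := exists_formula f ho
  have key := (transfer f ((at3 α (tv (k := k) (0 : Fin 6)) (tv 1) (tv 3)).imp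
    ((at3 α (tv 3) (tv 2) (tv 5)).imp ((at3 α (tv 1) (tv 2) (tv 4)).imp
      (at3 α (tv 0) (tv 4) (tv 5)))))).1 (by
      intro x
      simp only [FirstOrder.Language.Formula.realize_imp, realize_at3, elim_tv, ← hα]
      intro h1 h2 h3
      obtain ⟨a1, b1, h1⟩ := cat3_mem_graph.1 h1
      obtain ⟨a2, b2, h2⟩ := cat3_mem_graph.1 h2
      obtain ⟨a3, b3, h3⟩ := cat3_mem_graph.1 h3
      refine cat3_mem_graph.2 ⟨a1, h3 ▸ Subtype.property _, ?_⟩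
      simp only [← h1, ← h2, ← h3, Subtype.coe_eta, hl]) (fun i => ![a, b, c, p, q, r] i.1 i.2)
  simp only [FirstOrder.Language.Formula.realize_imp, realize_at3, elim_tv, ← hα'] at key
  exact key h1 h2 h3

theorem bar_comm (f : M ↪ₑ[L] N) {C : Set (Fin k → M)}
    {o : C → C → C} (ho : (∅ : Set M).Definable L (graph o))
    (hl : ∀ a b, o a b = o b a) {a b c : Fin k → N}
    (h : cat3 a b c ∈ interp f (graph o)) : cat3 b a c ∈ interp f (graph o) := by
  obtain ⟨α, hα, hα'⟩ := exists_formula f ho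
  have key := (transfer f ((at3 α (tv (k := k) (0 : Fin 3)) (tv 1) (tv 2)).imp
    (at3 α (tv 1) (tv 0) (tv 2)))).1 (by
      intro x
      simp only [FirstOrder.Language.Formula.realize_imp, realize_at3, elim_tv, ← hα]
      intro h
      obtain ⟨a1, b1, h1⟩ := cat3_mem_graph.1 h
      exact cat3_mem_graph.2 ⟨b1, a1, by rw [hl, h1]⟩) (cat3 a b c)
  simp only [FirstOrder.Language.Formula.realize_imp, realize_at3, elim_tv, ← hα'] at key
  exact key h

theorem bar_id (f : M ↪ₑ[L] N) {C : Set (Fin k → M)} (hC : (∅ : Set M).Definable L C)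
    {o : C → C → C} (ho : (∅ : Set M).Definable L (graph o)) {e : C}
    (hl : ∀ a, o e a = a) {a : Fin k → N} (ha : a ∈ interp f C) :
    cat3 (f ∘ e.1) a a ∈ interp f (graph o) := by
  obtain ⟨δ, hδ, hδ'⟩ := exists_formula f hC
  obtain ⟨α, hα, hα'⟩ := exists_formula f ho
  have key := (transfer f ((δ.relabel (tv (k := k) (0 : Fin 1))).imp
    (at3 α (pv e.1) (tv 0) (tv 0)))).1 (by
      intro x
      simp only [FirstOrder.Language.Formula.realize_imp, realize_at3, FirstOrder.Language.Formula.realize_relabel,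
        elim_tv, elim_pv, ← hα, ← hδ]
      intro h
      exact cat3_mem_graph.2 ⟨e.2, h, congrArg Subtype.val (hl ⟨_, h⟩)⟩) (fun p => a p.2)
  simp only [FirstOrder.Language.Formula.realize_imp, realize_at3, FirstOrder.Language.Formula.realize_relabel,
        elim_tv, elim_pv, ← hα', ← hδ'] at key
  exact key ha

theorem bar_inv (f : M ↪ₑ[L] N) {C : Set (Fin k → M)} (hC : (∅ : Set M).Definable L C)
    {o : C → C → C} (ho : (∅ : Set M).Definable L (graph o)) {e : C} {i : C → C}
    (hl : ∀ a, o (i a) a = e) {a : Fin k → N} (ha : a ∈ interp f C) :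
    ∃ b, cat3 b a (f ∘ e.1) ∈ interp f (graph o) := by
  obtain ⟨δ, hδ, hδ'⟩ := exists_formula f hC
  obtain ⟨α, hα, hα'⟩ := exists_formula f ho
  have key := (transfer f ((δ.relabel (tv (k := k) (0 : Fin 1))).imp
    (FirstOrder.Language.Formula.iExs (Fin k) (at3 α Sum.inr (Sum.inl ∘ tv 0) (Sum.inl ∘ pv e.1))))).1 (by
      intro x
      simp only [FirstOrder.Language.Formula.realize_imp, realize_at3, FirstOrder.Language.Formula.realize_iExs,
        FirstOrder.Language.Formula.realize_relabel, elim_tv, elim_pv, ← hα, ← hδ, ← Function.comp_assoc,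
        Sum.elim_comp_inl, Sum.elim_comp_inr]
      intro h
      exact ⟨(i ⟨_, h⟩).1, cat3_mem_graph.2 ⟨(i ⟨_, h⟩).2, h, by
        rw [Subtype.coe_eta, hl]; rfl⟩⟩) (fun p => a p.2)
  simp only [FirstOrder.Language.Formula.realize_imp, realize_at3, FirstOrder.Language.Formula.realize_iExs,
        FirstOrder.Language.Formula.realize_relabel, elim_tv, elim_pv, ← hα', ← hδ', ← Function.comp_assoc,
        Sum.elim_comp_inl, Sum.elim_comp_inr] at key
  exact key ha

theorem bar_distrib (f : M ↪ₑ[L] N) {C : Set (Fin k → M)}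
    {o o' : C → C → C} (ho : (∅ : Set M).Definable L (graph o))
    (ho' : (∅ : Set M).Definable L (graph o'))
    (hl : ∀ a b c, o' a (o b c) = o (o' a b) (o' a c)) {a b c s p q r : Fin k → N}
    (h1 : cat3 b c s ∈ interp f (graph o)) (h2 : cat3 a s p ∈ interp f (graph o'))
    (h3 : cat3 a b q ∈ interp f (graph o')) (h4 : cat3 a c r ∈ interp f (graph o')) :
    cat3 q r p ∈ interp f (graph o) := by
  obtain ⟨α, hα, hα'⟩ := exists_formula f ho
  obtain ⟨μ, hμ, hμ'⟩ := exists_formula f ho'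
  have key := (transfer f ((at3 α (tv (k := k) (1 : Fin 7)) (tv 2) (tv 3)).imp
    ((at3 μ (tv 0) (tv 3) (tv 4)).imp ((at3 μ (tv 0) (tv 1) (tv 5)).imp
      ((at3 μ (tv 0) (tv 2) (tv 6)).imp (at3 α (tv 5) (tv 6) (tv 4))))))).1 (by
      intro x
      simp only [FirstOrder.Language.Formula.realize_imp, realize_at3, elim_tv, ← hα, ← hμ]
      intro h1 h2 h3 h4
      obtain ⟨a1, b1, h1⟩ := cat3_mem_graph.1 h1
      obtain ⟨a2, b2, h2⟩ := cat3_mem_graph.1 h2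
      obtain ⟨a3, b3, h3⟩ := cat3_mem_graph.1 h3
      obtain ⟨a4, b4, h4⟩ := cat3_mem_graph.1 h4
      refine cat3_mem_graph.2 ⟨h3 ▸ Subtype.property _, h4 ▸ Subtype.property _, ?_⟩
      simp only [← h1, ← h2, ← h3, ← h4, Subtype.coe_eta, hl])
    (fun i => ![a, b, c, s, p, q, r] i.1 i.2)
  simp only [FirstOrder.Language.Formula.realize_imp, realize_at3, elim_tv, ← hα', ← hμ'] at key
  exact key h1 h2 h3 h4

end Transfer

section BarRing

variable (R : DefinableCommRing L M k) (f : M ↪ₑ[L] N)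

theorem exists_add (a b : R.Bar f) : ∃ c : R.Bar f, cat3 a.1 b.1 c.1 ∈ interp f R.addGraph := by
  obtain ⟨c, hc⟩ := bar_total f R.definable_carrier (o := (· + ·)) R.definable_add a.2 b.2
  exact ⟨⟨c, (bar_dom f R.definable_carrier (o := (· + ·)) R.definable_add hc).2.2⟩, hc⟩

theorem exists_mul (a b : R.Bar f) : ∃ c : R.Bar f, cat3 a.1 b.1 c.1 ∈ interp f R.mulGraph := by
  obtain ⟨c, hc⟩ := bar_total f R.definable_carrier (o := (· * ·)) R.definable_mul a.2 b.2
  exact ⟨⟨c, (bar_dom f R.definable_carrier (o := (· * ·)) R.definable_mul hc).2.2⟩, hc⟩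

/-- The inclusion of `R` in its interpretation in `N`. -/
def toBar (a : R.carrier) : R.Bar f := ⟨f ∘ a.1, comp_mem f R.definable_carrier a⟩

theorem exists_neg (a : R.Bar f) :
    ∃ b : R.Bar f, cat3 b.1 a.1 (R.toBar f 0).1 ∈ interp f R.addGraph := by
  obtain ⟨b, hb⟩ := bar_inv f R.definable_carrier (o := (· + ·)) R.definable_add
    (e := 0) (i := fun a => -a) neg_add_cancel a.2
  exact ⟨⟨b, (bar_dom f R.definable_carrier (o := (· + ·)) R.definable_add hb).1⟩, hb⟩

noncomputable instance : Add (R.Bar f) := ⟨fun a b => (R.exists_add f a b).choose⟩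
noncomputable instance : Mul (R.Bar f) := ⟨fun a b => (R.exists_mul f a b).choose⟩
noncomputable instance : Neg (R.Bar f) := ⟨fun a => (R.exists_neg f a).choose⟩
noncomputable instance : Zero (R.Bar f) := ⟨R.toBar f 0⟩
noncomputable instance : One (R.Bar f) := ⟨R.toBar f 1⟩

theorem add_spec (a b : R.Bar f) : cat3 a.1 b.1 (a + b).1 ∈ interp f R.addGraph :=
  (R.exists_add f a b).choose_spec

theorem mul_spec (a b : R.Bar f) : cat3 a.1 b.1 (a * b).1 ∈ interp f R.mulGraph :=
  (R.exists_mul f a b).choose_spec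

theorem neg_spec (a : R.Bar f) : cat3 (-a).1 a.1 (0 : R.Bar f).1 ∈ interp f R.addGraph :=
  (R.exists_neg f a).choose_spec

theorem eq_add {a b c : R.Bar f} (h : cat3 a.1 b.1 c.1 ∈ interp f R.addGraph) : a + b = c :=
  Subtype.ext (bar_unique f (o := (· + ·)) R.definable_add (R.add_spec f a b) h)

theorem eq_mul {a b c : R.Bar f} (h : cat3 a.1 b.1 c.1 ∈ interp f R.mulGraph) : a * b = c :=
  Subtype.ext (bar_unique f (o := (· * ·)) R.definable_mul (R.mul_spec f a b) h)

protected theorem bar_add_comm (a b : R.Bar f) : a + b = b + a :=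
  R.eq_add f (bar_comm f (o := (· + ·)) R.definable_add add_comm (R.add_spec f b a))

protected theorem bar_mul_comm (a b : R.Bar f) : a * b = b * a :=
  R.eq_mul f (bar_comm f (o := (· * ·)) R.definable_mul mul_comm (R.mul_spec f b a))

protected theorem bar_zero_add (a : R.Bar f) : 0 + a = a :=
  R.eq_add f (bar_id f R.definable_carrier (o := (· + ·)) R.definable_add (e := 0) zero_add a.2)

protected theorem bar_one_mul (a : R.Bar f) : 1 * a = a :=
  R.eq_mul f (bar_id f R.definable_carrier (o := (· * ·)) R.definable_mul (e := 1) one_mul a.2)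

protected theorem bar_mul_add (a b c : R.Bar f) : a * (b + c) = a * b + a * c :=
  (R.eq_add f (bar_distrib f (o := (· + ·)) (o' := (· * ·)) R.definable_add R.definable_mul mul_add
    (R.add_spec f b c) (R.mul_spec f a (b + c)) (R.mul_spec f a b) (R.mul_spec f a c))).symm

protected theorem bar_zero_mul (a : R.Bar f) : 0 * a = 0 := by
  have h := R.bar_mul_add f a 0 0
  rw [R.bar_zero_add, R.bar_mul_comm f a 0] at h
  have hneg := R.eq_add f (R.neg_spec f (0 * a))
  have hassoc := R.eq_add f (bar_assoc f (o := (· + ·)) R.definable_add add_assoc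
    (R.add_spec f (-(0 * a)) (0 * a)) (R.add_spec f _ (0 * a)) (R.add_spec f (0 * a) (0 * a)))
  rw [← h, hneg, R.bar_zero_add] at hassoc
  exact hassoc.symm

noncomputable instance barRing : CommRing (R.Bar f) where
  add_assoc a b c := (R.eq_add f (bar_assoc f (o := (· + ·)) R.definable_add add_assoc
    (R.add_spec f a b) (R.add_spec f (a + b) c) (R.add_spec f b c))).symm
  zero_add := R.bar_zero_add f
  add_zero a := by rw [R.bar_add_comm, R.bar_zero_add]
  add_comm := R.bar_add_comm f
  left_distrib := R.bar_mul_add f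
  right_distrib a b c := by
    rw [R.bar_mul_comm, R.bar_mul_add, R.bar_mul_comm f c a, R.bar_mul_comm f c b]
  zero_mul := R.bar_zero_mul f
  mul_zero a := by rw [R.bar_mul_comm, R.bar_zero_mul]
  mul_assoc a b c := (R.eq_mul f (bar_assoc f (o := (· * ·)) R.definable_mul mul_assoc
    (R.mul_spec f a b) (R.mul_spec f (a * b) c) (R.mul_spec f b c))).symm
  one_mul := R.bar_one_mul f
  mul_one a := by rw [R.bar_mul_comm, R.bar_one_mul]
  mul_comm := R.bar_mul_comm f
  neg_add_cancel a := R.eq_add f (R.neg_spec f a)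
  nsmul := nsmulRec
  zsmul := zsmulRec

end BarRing

end DefinableCommRing

/-- `N` is a monster model with respect to the cardinal `κ`: `κ` is an uncountable strong limit
cardinal greater than the cardinality of the language (so greater than that of the theory of `N`),
and `N` is `κ`-saturated and strongly `κ`-homogeneous. -/
structure IsMonster (L : FirstOrder.Language.{u, v}) (N : Type w') [L.Structure N] (κ : Cardinal.{w'}) :
    Prop where
  isStrongLimit : κ.IsStrongLimit
  aleph0_lt : ℵ₀ < κ
  card_lt : Cardinal.lift.{w'} L.card < Cardinal.lift.{max u v} κ
  /-- Every finitely satisfiable set of formulas in one variable over a set of fewer than `κ`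
  parameters is realized. -/
  saturated : ∀ B : Set N, #B < κ → ∀ p : Set (L.Formula (B ⊕ Unit)),
    (∀ q : Finset (L.Formula (B ⊕ Unit)), (q : Set (L.Formula (B ⊕ Unit))) ⊆ p →
      ∃ x : N, ∀ φ ∈ q, φ.Realize (Sum.elim Subtype.val fun _ => x)) →
    ∃ x : N, ∀ φ ∈ p, φ.Realize (Sum.elim Subtype.val fun _ => x)
  /-- Every partial elementary map with a domain of fewer than `κ` elements extends to an
  automorphism. -/
  homogeneous : ∀ B : Set N, #B < κ → ∀ g : B → N,
    (∀ φ : L.Formula B, φ.Realize Subtype.val ↔ φ.Realize g) →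
    ∃ σ : N ≃[L] N, ∀ b : B, σ b = g b

/-- A subset `D` of an additive group is thick if it is symmetric and for some `n > 0`, among any
`n` elements there are two, at different places, whose difference lies in `D`. -/
def IsThick {G : Type*} [AddGroup G] (D : Set G) : Prop :=
  (∀ x ∈ D, -x ∈ D) ∧
    ∃ n : ℕ, 0 < n ∧ ∀ g : Fin n → G, ∃ i j : Fin n, i < j ∧ -g i + g j ∈ D

/-- The `n`-fold sum `X + ⋯ + X`; it is `{0}` for `n = 0`. -/
def nfoldSum {G : Type*} [AddCommMonoid G] (n : ℕ) (X : Set G) : Set G :=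
  {x | ∃ s : Fin n → G, (∀ i, s i ∈ X) ∧ x = ∑ i, s i}

/-- The three versions (left, right, two-sided) of the conditions. -/
inductive Side
  | left
  | right
  | both

/-- The sets `(R ∪ {1}) · D`, `D · (R ∪ {1})` and `(R ∪ {1}) · D · (R ∪ {1})`;
here `R ∪ {1} = R`, since `R` is unital. -/
def Side.mulSet {R : Type*} [CommRing R] : Side → Set R → Set R
  | .left, D => {x | ∃ r : R, ∃ d ∈ D, x = r * d}
  | .right, D => {x | ∃ d ∈ D, ∃ r : R, x = d * r}
  | .both, D => {x | ∃ r : R, ∃ d ∈ D, ∃ s : R, x = r * d * s}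

section Components

variable {L : FirstOrder.Language.{u, v}} {M : Type w} {N : Type w'} [L.Structure M] [L.Structure N]

/-- A set of elements of a type of `k`-tuples is `A`-definable. -/
def IsDef (L : FirstOrder.Language.{u, v}) {P : Type*} [L.Structure P] (A : Set P) {k : ℕ}
    {C : Set (Fin k → P)} (S : Set C) : Prop :=
  A.Definable L (Subtype.val '' S)

/-- `A`-type-definable: an intersection of `A`-definable sets. -/
def IsTypeDef (L : FirstOrder.Language.{u, v}) {P : Type*} [L.Structure P] (A : Set P) {k : ℕ}
    {C : Set (Fin k → P)} (S : Set C) : Prop :=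
  ∃ F : Set (Set (Fin k → P)), (∀ T ∈ F, A.Definable L T) ∧ Subtype.val '' S = ⋂₀ F

/-- `A`-invariant: preserved by all automorphisms that fix `A` pointwise. -/
def IsInv (L : FirstOrder.Language.{u, v}) {P : Type*} [L.Structure P] (A : Set P) {k : ℕ}
    {C : Set (Fin k → P)} (S : Set C) : Prop :=
  ∀ σ : P ≃[L] P, (∀ a ∈ A, σ a = a) →
    ∀ x ∈ (Subtype.val '' S : Set (Fin k → P)), σ ∘ x ∈ (Subtype.val '' S : Set (Fin k → P))

namespace DefinableCommRing

variable {k : ℕ} (R : DefinableCommRing L M k)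

/-- The interpretation in `N` of a definable subset `D` of `R`. -/
def barSet (f : M ↪ₑ[L] N) (D : Set R.carrier) : Set (R.Bar f) :=
  {y | y.1 ∈ interp f (Subtype.val '' D)}

variable (f : M ↪ₑ[L] N) (A : Set M) (κ : Cardinal.{w'})

/-- The component `(R̄, +)⁰_A`: the intersection of all `A`-definable subgroups of finite index. -/
noncomputable def addComp0 : AddSubgroup (R.Bar f) :=
  sInf {H | IsDef L (f '' A) (H : Set (R.Bar f)) ∧ H.FiniteIndex}

/-- The component `(R̄, +)⁰⁰_A`: the smallest `A`-type-definable subgroup of bounded index,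
that is, the intersection of all such subgroups. -/
noncomputable def addComp00 : AddSubgroup (R.Bar f) :=
  sInf {H | IsTypeDef L (f '' A) (H : Set (R.Bar f)) ∧ #(R.Bar f ⧸ H) < κ}

/-- The component `R̄⁰_A`: the intersection of all `A`-definable ideals of finite index. -/
noncomputable def comp0 : Ideal (R.Bar f) :=
  sInf {I | IsDef L (f '' A) (I : Set (R.Bar f)) ∧ Finite (R.Bar f ⧸ I)}

/-- The component `R̄⁰⁰_A`: the smallest `A`-type-definable ideal of bounded index. -/
noncomputable def comp00 : Ideal (R.Bar f) :=
  sInf {I | IsTypeDef L (f '' A) (I : Set (R.Bar f)) ∧ #(R.Bar f ⧸ I) < κ}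

/-- The component `R̄⁰⁰⁰_A`: the smallest `A`-invariant ideal of bounded index. -/
noncomputable def comp000 : Ideal (R.Bar f) :=
  sInf {I | IsInv L (f '' A) (I : Set (R.Bar f)) ∧ #(R.Bar f ⧸ I) < κ}

/-- The subset `Y` of `R` contains an `A`-definable ideal of `R` of finite index. -/
def ContainsIdeal (Y : Set R.carrier) : Prop :=
  ∃ I : Ideal R.carrier, IsDef L A (I : Set R.carrier) ∧ Finite (R.carrier ⧸ I) ∧
    (I : Set R.carrier) ⊆ Y

/-- Condition (i): with `X = (R̄, +)⁰⁰_A`, the subgroup `J` generated by `X_i` is the `n`-fold sum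
of `X_i`. Its equivalent forms, with `R̄⁰⁰⁰_A` or `R̄⁰⁰_A` in the place of `J`, are included. -/
def CondI (i : Side) (n : ℕ) : Prop :=
  (AddSubgroup.closure (i.mulSet (R.addComp00 f A κ : Set (R.Bar f))) : Set (R.Bar f)) =
      nfoldSum n (i.mulSet (R.addComp00 f A κ : Set (R.Bar f))) ∧
    (R.comp000 f A κ : Set (R.Bar f)) =
      nfoldSum n (i.mulSet (R.addComp00 f A κ : Set (R.Bar f))) ∧
    (R.comp00 f A κ : Set (R.Bar f)) =
      nfoldSum n (i.mulSet (R.addComp00 f A κ : Set (R.Bar f)))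

/-- Condition (ii): for every `A`-definable `D ⊆ R` with `(R̄, +)⁰⁰_A ⊆ D̄`, the `n`-fold sum of
`D_i` contains an `A`-definable ideal of finite index. -/
def CondII (i : Side) (n : ℕ) : Prop :=
  ∀ D : Set R.carrier, IsDef L A D → (R.addComp00 f A κ : Set (R.Bar f)) ⊆ R.barSet f D →
    R.ContainsIdeal A (nfoldSum n (i.mulSet D))

/-- Condition (iii): for every `A`-definable subgroup `H` of `(R, +)` of finite index, the
`n`-fold sum of `H_i` contains an `A`-definable ideal of finite index. -/
def CondIII (i : Side) (n : ℕ) : Prop :=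
  ∀ H : AddSubgroup R.carrier, IsDef L A (H : Set R.carrier) → H.FiniteIndex →
    R.ContainsIdeal A (nfoldSum n (i.mulSet (H : Set R.carrier)))

/-- Condition (iv): with `X' = (R̄, +)⁰_A`, the subgroup `J'_i` generated by `X'_i` is the `n`-fold
sum of `X'_i`. -/
def CondIV (i : Side) (n : ℕ) : Prop :=
  (AddSubgroup.closure (i.mulSet (R.addComp0 f A : Set (R.Bar f))) : Set (R.Bar f)) =
    nfoldSum n (i.mulSet (R.addComp0 f A : Set (R.Bar f)))

/-- Condition (v): the `n`-fold sum of `X'_i` is `R̄⁰_A`. -/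
def CondV (i : Side) (n : ℕ) : Prop :=
  nfoldSum n (i.mulSet (R.addComp0 f A : Set (R.Bar f))) = (R.comp0 f A : Set (R.Bar f))

end DefinableCommRing

end Components

end ModelRing

/-! Everything rests on one algebraic fact: a thick subset of R contains m elements that generate an
ideal of finite index, where m = n + 1, or m = n in positive characteristic. A ring with n
generators is Noetherian with finite residue fields, and it is a quotient of a polynomial ring in n
variables over ℤ, or over the finite ring `ZMod c` if the characteristic c is positive. So its Krull
dimension is at most m. By B. H. Neumann's covering lemma a thick set is not contained in a finite
union of ideals of infinite index (`IsThick.exists_notMem`). Hence d₁, …, d_m can be chosen in it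
one at a time, each outside the infinite-index minimal primes over the earlier ones. Heights then
grow until no prime of infinite index contains all of them (`IsThick.exists_finite_quotient_span`),
and in a Noetherian ring this makes the index of (d₁, …, d_m) finite.

Every element of R is definable over A, because the generators have their coordinates in A. So
finitely generated ideals are A-definable and have counterparts in the monster model
(`exists_corr_span`). This gives the statements about subsets of R.

For the components, let Y be A-type-definable such that every A-definable set around Y has a thick
symmetric part in R. Compactness then puts the ideal component inside the m-fold sum of multiples of
Y (`comp0_subset_nfoldSum`). The thickness comes from differences of elements of equal type over a
small set: an invariant subgroup of bounded index contains them (`exists_sameTypeDiff_subset`), and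
a definable set that contains them is thick, up to symmetrization, by compactness and the pigeonhole
principle (`isThick_of_sameTypeDiff_subset`). The same method, applied to `typeDefHull`, shows that
an invariant ideal of bounded index contains the component `comp0`, so the three ideal components
coincide. -/

namespace ModelRing

/-! ### Thick sets and ideals of finite index in finitely generated rings -/

section Algebra

/-- A thick set is not contained in a finite union of ideals of infinite index. -/
theorem IsThick.exists_notMem {R : Type*} [CommRing R] {D : Set R} (hD : IsThick D)
    (P : Finset (Ideal R)) (hP : ∀ I ∈ P, Infinite (R ⧸ I)) : ∃ d ∈ D, ∀ I ∈ P, d ∉ I := by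
  by_contra! hcon
  obtain ⟨-, m, -, hm⟩ := hD
  -- If every d ∈ D lay in a member of P, an infinite sequence whose differences avoid all members
  -- of P would contradict thickness.
  obtain ⟨g, -, hg⟩ := exists_seq_of_forall_finset_exists (fun _ : R => True)
    (fun x y => ∀ I ∈ P, -x + y ∉ I) (by
      intro s _
      by_contra! hs
      -- B. H. Neumann's lemma: if the sequence cannot be continued, finitely many cosets x + I
      -- cover R, so one of these I has finite index.
      obtain ⟨⟨x, I⟩, hxI, hfin⟩ := AddSubgroup.exists_finiteIndex_of_leftCoset_cover
        (s := s ×ˢ P) (g := fun p => p.1) (H := fun p => p.2.toAddSubgroup) (by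
          refine Set.eq_univ_of_forall fun y => ?_
          obtain ⟨x, hx, I, hI, h⟩ := hs y trivial
          refine Set.mem_iUnion₂.2 ⟨(x, I), Finset.mem_product.2 ⟨hx, hI⟩, ?_⟩
          rw [Set.mem_vadd_set_iff_neg_vadd_mem]
          exact h)
      have : Finite (R ⧸ I) := AddSubgroup.finite_quotient_of_finiteIndex (H := I.toAddSubgroup)
      exact (hP I (Finset.mem_product.1 hxI).2).not_finite this)
  obtain ⟨i, j, hij, h⟩ := hm fun i => g i
  obtain ⟨I, hI, h'⟩ := hcon _ h
  exact hg i j hij I hI h'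

/-- Modulo J every x is p + aq, where p runs through representatives of R/(J + (a)) and q through
representatives of R/(J : a). The Oka property allows finiteness of the index to be checked on
primes only. -/
theorem isOka_finite_quotient {R : Type*} [CommRing R] (I : Ideal R) :
    Ideal.IsOka (fun J : Ideal R => I ≤ J → Finite (R ⧸ J)) where
  top _ := @Finite.of_subsingleton _ (Ideal.Quotient.subsingleton_iff.2 rfl)
  oka {J a} h₁ h₂ hIJ := by
    have := h₁ (hIJ.trans le_sup_left)
    have := h₂ (hIJ.trans Ideal.le_colon)
    refine Finite.of_surjective (fun p : (R ⧸ J ⊔ Ideal.span {a}) × (R ⧸ J.colon (Ideal.span {a} : Set R)) =>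
      Ideal.Quotient.mk J (p.1.out + a * p.2.out)) fun x => ?_
    obtain ⟨x, rfl⟩ := Ideal.Quotient.mk_surjective x
    have h1 : x - (Ideal.Quotient.mk (J ⊔ Ideal.span {a}) x).out ∈ J ⊔ Ideal.span {a} := by
      rw [← Ideal.Quotient.eq, Ideal.Quotient.mk_out]
    obtain ⟨j, hj, z, hz, h1⟩ := Submodule.mem_sup.1 h1
    obtain ⟨y, rfl⟩ := Ideal.mem_span_singleton'.1 hz
    have h2 : y - (Ideal.Quotient.mk (J.colon (Ideal.span {a} : Set R)) y).out ∈
        J.colon (Ideal.span {a} : Set R) := by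
      rw [← Ideal.Quotient.eq, Ideal.Quotient.mk_out]
    rw [Ideal.mem_colon_span_singleton] at h2
    refine ⟨(Ideal.Quotient.mk _ x, Ideal.Quotient.mk _ y), ?_⟩
    refine (Ideal.Quotient.eq.2 ?_).symm
    have : x - ((Ideal.Quotient.mk (J ⊔ Ideal.span {a}) x).out +
        a * (Ideal.Quotient.mk (J.colon (Ideal.span {a} : Set R)) y).out) =
        j + (y - (Ideal.Quotient.mk (J.colon (Ideal.span {a} : Set R)) y).out) * a := by
      linear_combination -h1
    rw [this]
    exact J.add_mem hj h2

/-- In a Noetherian ring an ideal has finite index if all primes above it have. -/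
theorem finite_quotient_of_forall_prime {R : Type*} [CommRing R] [IsNoetherianRing R]
    (I : Ideal R) (h : ∀ P : Ideal R, P.IsPrime → I ≤ P → Finite (R ⧸ P)) : Finite (R ⧸ I) := by
  -- An ideal maximal among those that violate an Oka property is prime; the Noetherian condition
  -- provides such a maximal one.
  refine (isOka_finite_quotient I).forall_of_forall_prime (fun J hJ => ?_) h I le_rfl
  obtain ⟨K, hK, hmax⟩ := set_has_maximal_iff_noetherian.2 (inferInstance : IsNoetherian R R)
    {J : Ideal R | ¬ (I ≤ J → Finite (R ⧸ J))} ⟨J, hJ⟩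
  exact ⟨K, hK, fun K' hK' hle => not_lt_iff_le_imp_ge.1 (hmax K' hK') hle⟩

/-- A variant of prime avoidance: each new element of D avoids the finitely many minimal primes of
infinite index over its predecessors, so the infinite-index primes above the chosen elements gain
height. After m choices such a prime would have height at least m. Having infinite index it is not
maximal, so a maximal ideal strictly above it would have height at least m + 1. -/
theorem IsThick.exists_finite_quotient_span {R : Type*} [CommRing R] [IsNoetherianRing R]
    (hmax : ∀ P : Ideal R, P.IsMaximal → Finite (R ⧸ P)) {m : ℕ} (hdim : ringKrullDim R ≤ m)
    {D : Set R} (hD : IsThick D) :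
    ∃ d : Fin m → R, (∀ i, d i ∈ D) ∧ Finite (R ⧸ Ideal.span (Set.range d)) := by
  have step : ∀ j : ℕ, ∃ d : Fin j → R, (∀ i, d i ∈ D) ∧ ∀ P : Ideal R, P.IsPrime →
      Infinite (R ⧸ P) → Ideal.span (Set.range d) ≤ P → (j : ℕ∞) ≤ P.height := by
    intro j
    induction j with
    | zero => exact ⟨Fin.elim0, fun i => i.elim0, fun P _ _ _ => by simp⟩
    | succ j ih =>
      obtain ⟨d, hd, hP⟩ := ih
      classical
      have hfin := (Ideal.span (Set.range d)).finite_minimalPrimes_of_isNoetherianRing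
      obtain ⟨e, he, heP⟩ := hD.exists_notMem
        (hfin.toFinset.filter fun Q => Infinite (R ⧸ Q)) (fun I hI => (Finset.mem_filter.1 hI).2)
      refine ⟨Fin.snoc d e, fun i => ?_, fun P hPp hPinf hle => ?_⟩
      · refine Fin.lastCases ?_ (fun i => ?_) i
        · simpa using he
        · simpa using hd i
      · have hdP : Ideal.span (Set.range d) ≤ P := by
          refine le_trans (Ideal.span_mono ?_) hle
          rintro _ ⟨i, rfl⟩
          exact ⟨i.castSucc, by simp⟩
        have heP' : e ∈ P := hle (Ideal.subset_span ⟨Fin.last j, by simp⟩)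
        obtain ⟨Q, hQ, hQP⟩ := Ideal.exists_minimalPrimes_le hdP
        -- R/P is a quotient of R/Q, so a minimal prime Q of finite index cannot lie below P; only
        -- those of infinite index need to be avoided.
        have hQinf : Infinite (R ⧸ Q) := by
          by_contra hf
          rw [not_infinite_iff_finite] at hf
          have := Finite.of_surjective _ (Ideal.Quotient.factor_surjective hQP)
          exact hPinf.not_finite this
        have hQp : Q.IsPrime := hQ.1.1
        have hlt : Q < P := lt_of_le_of_ne hQP (by
          rintro rfl
          exact heP Q (by simp [hQ, hQinf]) heP')
        have := hP Q hQp hQinf hQ.1.2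
        refine le_trans ?_ (Ideal.height_add_one_le_of_lt_of_isPrime hlt)
        push_cast
        gcongr
  obtain ⟨d, hd, hP⟩ := step m
  refine ⟨d, hd, finite_quotient_of_forall_prime _ fun P hPp hle => ?_⟩
  by_contra hinf
  rw [not_finite_iff_infinite] at hinf
  have h1 := hP P hPp hinf hle
  obtain ⟨Q, hQ, hPQ⟩ := Ideal.exists_le_maximal P hPp.ne_top
  rcases eq_or_lt_of_le hPQ with rfl | hlt
  · exact hinf.not_finite (hmax _ hQ)
  · have hQp := hQ.isPrime
    have h2 := Ideal.height_add_one_le_of_lt_of_isPrime hlt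
    have h3 := Ideal.height_le_ringKrullDim_of_ne_top hQp.ne_top
    have h4 : ((m + 1 : ℕ) : ℕ∞) ≤ Q.height := by
      refine le_trans ?_ h2
      push_cast
      gcongr
    have h5 : ((m + 1 : ℕ) : WithBot ℕ∞) ≤ m :=
      le_trans (by exact_mod_cast WithBot.coe_le_coe.2 h4) (h3.trans hdim)
    norm_cast at h5
    omega

/-- Only the zero ideal needs an argument: if x lies in its Jacobson radical, then x² + 1 is a unit
of ℤ, which forces x = 0. -/
theorem isJacobsonRing_int : IsJacobsonRing ℤ := by
  refine isJacobsonRing_iff_prime_eq.2 fun P hP => ?_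
  rcases eq_or_ne P ⊥ with rfl | hne
  · refine le_antisymm (fun x hx => ?_) Ideal.le_jacobson
    rcases Int.isUnit_iff.1 (Ideal.mem_jacobson_bot.1 hx x) with h | h <;>
    · rw [Ideal.mem_bot]
      nlinarith
  · have := hP.isMaximal hne
    exact Ideal.jacobson_eq_self_of_isMaximal

/-- The Nullstellensatz over the Jacobson ring ℤ makes K a finite ℤ-module. In characteristic 0 the
ring ℤ would then be a field by integrality; in characteristic p, K is finite over `ZMod p`. -/
theorem finite_of_field_of_finiteType_int {K : Type*} [Field K] [Algebra.FiniteType ℤ K] :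
    Finite K := by
  have := isJacobsonRing_int
  have hfin : Module.Finite ℤ K := finite_of_finite_type_of_isJacobsonRing ℤ K
  rcases CharP.exists K with ⟨p, hp⟩
  rcases Nat.eq_zero_or_pos p with rfl | hpos
  · have : CharZero K := CharP.charP_to_charZero K
    have hint : Algebra.IsIntegral ℤ K := inferInstance
    exact absurd (isField_of_isIntegral_of_isField (FaithfulSMul.algebraMap_injective ℤ K) (Field.toIsField K)) Int.not_isField
  · have : NeZero p := ⟨hpos.ne'⟩
    let _ : Algebra (ZMod p) K := ZMod.algebra K p
    have : IsScalarTower ℤ (ZMod p) K := inferInstance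
    have : Module.Finite (ZMod p) K := Module.Finite.of_restrictScalars_finite ℤ (ZMod p) K
    exact Module.finite_of_finite (ZMod p)

theorem mvPolynomial_aeval_surjective {R T : Type*} [CommRing R] [CommRing T] [Algebra T R]
    {S : Finset R} (hgen : Subring.closure (S : Set R) = ⊤) :
    Function.Surjective (MvPolynomial.aeval (R := T) (Subtype.val : S → R)) := by
  intro x
  have hx : x ∈ Subring.closure (S : Set R) := hgen ▸ Subring.mem_top x
  have : Subring.closure (S : Set R) ≤
      (MvPolynomial.aeval (R := T) (Subtype.val : S → R)).toRingHom.range := by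
    rw [Subring.closure_le]
    intro s hs
    exact ⟨MvPolynomial.X ⟨s, hs⟩, by simp⟩
  exact this hx

/-- R is a quotient of the polynomial ring over T with one variable for each generator. The base T
is left open so that both ℤ, of dimension 1, and a finite ring, of dimension 0, can be used. -/
theorem ringKrullDim_le_of_closure {R : Type*} (T : Type*) [CommRing R] [CommRing T] [Algebra T R]
    [IsNoetherianRing T] {S : Finset R} (hgen : Subring.closure (S : Set R) = ⊤) {a : ℕ}
    (ha : ringKrullDim T ≤ a) : ringKrullDim R ≤ (a + S.card : ℕ) := by
  refine (ringKrullDim_le_of_surjective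
    (MvPolynomial.aeval (R := T) (Subtype.val : S → R)).toRingHom
    (mvPolynomial_aeval_surjective hgen)).trans ?_
  rw [MvPolynomial.ringKrullDim_of_isNoetherianRing]
  push_cast
  gcongr
  simp

section FiniteGeneration

variable {R : Type*} [CommRing R] {S : Finset R} (hgen : Subring.closure (S : Set R) = ⊤)
  {D : Set R}
include hgen

theorem finiteType_int : Algebra.FiniteType ℤ R :=
  Algebra.FiniteType.of_surjective (MvPolynomial.aeval (R := ℤ) (Subtype.val : S → R))
    (mvPolynomial_aeval_surjective hgen)

theorem isNoetherianRing_of_closure : IsNoetherianRing R :=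
  have := finiteType_int hgen
  Algebra.FiniteType.isNoetherianRing ℤ R

theorem finite_quotient_of_isMaximal (P : Ideal R) (hP : P.IsMaximal) : Finite (R ⧸ P) := by
  have := finiteType_int hgen
  have h : Algebra.FiniteType ℤ (R ⧸ P) :=
    .of_surjective (Ideal.Quotient.mk P).toIntAlgHom Ideal.Quotient.mk_surjective
  exact @finite_of_field_of_finiteType_int _ (Ideal.Quotient.field P) h

/-- In a ring with `n` generators every thick set contains `n + 1` elements that generate an
ideal of finite index. -/
theorem IsThick.exists_fin_succ (hD : IsThick D) : ∃ d : Fin (S.card + 1) → R, (∀ i, d i ∈ D) ∧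
    Finite (R ⧸ Ideal.span (Set.range d)) := by
  have := isNoetherianRing_of_closure hgen
  refine hD.exists_finite_quotient_span (finite_quotient_of_isMaximal hgen) ?_
  rw [add_comm]
  exact ringKrullDim_le_of_closure ℤ hgen (Ring.krullDimLE_iff.1 inferInstance)

/-- In a ring of positive characteristic with `n` generators every thick set contains `n` elements
that generate an ideal of finite index. -/
theorem IsThick.exists_fin (hD : IsThick D) (hchar : 0 < ringChar R) :
    ∃ d : Fin S.card → R, (∀ i, d i ∈ D) ∧ Finite (R ⧸ Ideal.span (Set.range d)) := by
  have := isNoetherianRing_of_closure hgen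
  refine hD.exists_finite_quotient_span (finite_quotient_of_isMaximal hgen) ?_
  have : NeZero (ringChar R) := ⟨hchar.ne'⟩
  let _ : Algebra (ZMod (ringChar R)) R := ZMod.algebra R (ringChar R)
  -- A finite base ring has dimension 0 instead of 1, which saves one summand.
  have h := ringKrullDim_le_of_closure (ZMod (ringChar R)) hgen (a := 0)
    (Ring.krullDimLE_iff.1 inferInstance)
  simpa using h

end FiniteGeneration

end Algebra

/-! ### Relations on R and on its interpretation given by the same formula over A -/

section Correspondence

open DefinableCommRing

variable {L : FirstOrder.Language.{u, v}} {M : Type w} {N : Type w'} [L.Structure M] [L.Structure N]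
  {k : ℕ}

/-- The coordinates of a family of tuples. -/
def coords {V : Type*} {C : Set (Fin k → V)} {σ : Type} (g : σ → C) : σ × Fin k → V :=
  fun p => (g p.1).1 p.2

variable (R : DefinableCommRing L M k) (f : M ↪ₑ[L] N) (A : Set M)

/-- A relation on `R` and a relation on its interpretation are defined by the same formula
over `A`. -/
def Corr {σ : Type} (P : (σ → R.carrier) → Prop) (Q : (σ → R.Bar f) → Prop) : Prop :=
  ∃ φ : L.Formula (A ⊕ (σ × Fin k)),
    (∀ g, P g ↔ φ.Realize (Sum.elim Subtype.val (coords g))) ∧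
    ∀ g, Q g ↔ φ.Realize (Sum.elim (fun a => f a) (coords g))

/-- A function on `R` and a function on its interpretation are defined by the same formula
over `A`. -/
def CorrTerm {σ : Type} (t : (σ → R.carrier) → R.carrier) (t' : (σ → R.Bar f) → R.Bar f) : Prop :=
  Corr R f A (σ := Option σ) (fun g => g none = t (g ∘ some)) (fun g => g none = t' (g ∘ some))

variable {R f A} {σ τ : Type}

namespace Corr

variable {P P₁ P₂ : (σ → R.carrier) → Prop} {Q Q₁ Q₂ : (σ → R.Bar f) → Prop}

theorem congr (h : Corr R f A P Q) (hP : ∀ g, P₁ g ↔ P g) (hQ : ∀ g, Q₁ g ↔ Q g) :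
    Corr R f A P₁ Q₁ := by
  obtain ⟨φ, h1, h2⟩ := h
  exact ⟨φ, fun g => (hP g).trans (h1 g), fun g => (hQ g).trans (h2 g)⟩

theorem not (h : Corr R f A P Q) : Corr R f A (fun g => ¬ P g) (fun g => ¬ Q g) := by
  obtain ⟨φ, h1, h2⟩ := h
  exact ⟨φ.not, fun g => by beta_reduce; rw [Language.Formula.realize_not, h1],
    fun g => by beta_reduce; rw [Language.Formula.realize_not, h2]⟩

theorem and (h : Corr R f A P₁ Q₁) (h' : Corr R f A P₂ Q₂) :
    Corr R f A (fun g => P₁ g ∧ P₂ g) (fun g => Q₁ g ∧ Q₂ g) := by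
  obtain ⟨φ, h1, h2⟩ := h
  obtain ⟨ψ, h3, h4⟩ := h'
  exact ⟨φ ⊓ ψ, fun g => by beta_reduce; rw [Language.Formula.realize_inf, h1, h3],
    fun g => by beta_reduce; rw [Language.Formula.realize_inf, h2, h4]⟩

theorem forall_index {ι : Type*} [Finite ι] {P : ι → (σ → R.carrier) → Prop}
    {Q : ι → (σ → R.Bar f) → Prop} (h : ∀ i, Corr R f A (P i) (Q i)) :
    Corr R f A (fun g => ∀ i, P i g) (fun g => ∀ i, Q i g) := by
  choose φ h1 h2 using h
  exact ⟨Language.Formula.iInf φ,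
    fun g => by rw [Language.Formula.realize_iInf]; exact forall_congr' fun i => h1 i g,
    fun g => by rw [Language.Formula.realize_iInf]; exact forall_congr' fun i => h2 i g⟩

theorem exists_index {ι : Type*} [Finite ι] {P : ι → (σ → R.carrier) → Prop}
    {Q : ι → (σ → R.Bar f) → Prop} (h : ∀ i, Corr R f A (P i) (Q i)) :
    Corr R f A (fun g => ∃ i, P i g) (fun g => ∃ i, Q i g) :=
  (forall_index fun i => (h i).not).not.congr (fun g => by simp) (fun g => by simp)

theorem reindex (h : Corr R f A P Q) (t : σ → τ) :
    Corr R f A (fun g : τ → R.carrier => P (g ∘ t)) (fun g => Q (g ∘ t)) := by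
  obtain ⟨φ, h1, h2⟩ := h
  refine ⟨φ.relabel (Sum.map id (Prod.map t id)), fun g => ?_, fun g => ?_⟩
  · beta_reduce
    rw [Language.Formula.realize_relabel, h1, Sum.elim_comp_map]
    rfl
  · beta_reduce
    rw [Language.Formula.realize_relabel, h2, Sum.elim_comp_map]
    rfl

/-- A quantifier over ring elements is a quantifier over k-tuples relativized to the formula δ of
the carrier, and δ defines the carrier in both models. -/
theorem ex [Finite τ] {P : (σ ⊕ τ → R.carrier) → Prop} {Q : (σ ⊕ τ → R.Bar f) → Prop}
    (h : Corr R f A P Q) : Corr R f A (fun g => ∃ x : τ → R.carrier, P (Sum.elim g x))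
      (fun g => ∃ x : τ → R.Bar f, Q (Sum.elim g x)) := by
  obtain ⟨φ, h1, h2⟩ := h
  obtain ⟨δ, hδ, hδ'⟩ := exists_formula f R.definable_carrier
  let e : A ⊕ ((σ ⊕ τ) × Fin k) → (A ⊕ (σ × Fin k)) ⊕ (τ × Fin k) :=
    Sum.elim (Sum.inl ∘ Sum.inl) fun p =>
      Sum.elim (fun s => Sum.inl (Sum.inr (s, p.2))) (fun t => Sum.inr (t, p.2)) p.1
  refine ⟨Language.Formula.iExs (τ × Fin k)
    (Language.Formula.iInf (fun t : τ => δ.relabel fun j => Sum.inr (t, j)) ⊓ φ.relabel e),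
    fun g => ?_, fun g => ?_⟩
  · rw [Language.Formula.realize_iExs]
    constructor
    · rintro ⟨x, hx⟩
      refine ⟨coords x, ?_⟩
      rw [Language.Formula.realize_inf, Language.Formula.realize_iInf]
      refine ⟨fun t => ?_, ?_⟩
      · rw [Language.Formula.realize_relabel]
        exact (hδ _).1 (x t).2
      · rw [Language.Formula.realize_relabel]
        convert (h1 _).1 hx using 1
        funext p
        rcases p with a | ⟨s | t, j⟩ <;> rfl
    · rintro ⟨y, hy⟩
      rw [Language.Formula.realize_inf, Language.Formula.realize_iInf] at hy
      refine ⟨fun t => ⟨fun j => y (t, j), (hδ _).2 ?_⟩, (h1 _).2 ?_⟩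
      · have := hy.1 t
        rw [Language.Formula.realize_relabel] at this
        exact this
      · have := hy.2
        rw [Language.Formula.realize_relabel] at this
        convert this using 1
        funext p
        rcases p with a | ⟨s | t, j⟩ <;> rfl
  · rw [Language.Formula.realize_iExs]
    constructor
    · rintro ⟨x, hx⟩
      refine ⟨coords x, ?_⟩
      rw [Language.Formula.realize_inf, Language.Formula.realize_iInf]
      refine ⟨fun t => ?_, ?_⟩
      · rw [Language.Formula.realize_relabel]
        exact (hδ' _).1 (x t).2
      · rw [Language.Formula.realize_relabel]
        convert (h2 _).1 hx using 1
        funext p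
        rcases p with a | ⟨s | t, j⟩ <;> rfl
    · rintro ⟨y, hy⟩
      rw [Language.Formula.realize_inf, Language.Formula.realize_iInf] at hy
      refine ⟨fun t => ⟨fun j => y (t, j), (hδ' _).2 ?_⟩, (h2 _).2 ?_⟩
      · have := hy.1 t
        rw [Language.Formula.realize_relabel] at this
        exact this
      · have := hy.2
        rw [Language.Formula.realize_relabel] at this
        convert this using 1
        funext p
        rcases p with a | ⟨s | t, j⟩ <;> rfl

theorem all [Finite τ] {P : (σ ⊕ τ → R.carrier) → Prop} {Q : (σ ⊕ τ → R.Bar f) → Prop}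
    (h : Corr R f A P Q) : Corr R f A (fun g => ∀ x : τ → R.carrier, P (Sum.elim g x))
      (fun g => ∀ x : τ → R.Bar f, Q (Sum.elim g x)) :=
  h.not.ex.not.congr (fun g => by simp) (fun g => by simp)

/-- Once all variables are quantified a sentence over A remains, and `f` is elementary. -/
theorem transfer_exists [Finite σ] (h : Corr R f A P Q) : (∃ g, P g) ↔ ∃ g, Q g := by
  obtain ⟨φ, h1, h2⟩ := (h.reindex (Sum.inr : σ → Empty ⊕ σ)).ex
  have key := f.map_formula φ (Sum.elim Subtype.val (coords (C := R.carrier) Empty.elim))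
  have h1 := h1 Empty.elim
  have h2 := h2 Empty.elim
  simp only [Sum.elim_comp_inr] at h1 h2
  rw [h1, h2, ← key]
  refine iff_of_eq (congrArg _ ?_)
  funext p
  rcases p with a | ⟨s, j⟩
  · rfl
  · exact s.elim

theorem transfer_forall [Finite σ] (h : Corr R f A P Q) : (∀ g, P g) ↔ ∀ g, Q g := by
  have := h.not.transfer_exists
  rw [← not_iff_not]
  simpa using this

theorem invariant (h : Corr R f A P Q) (e : N ≃[L] N) (he : ∀ a ∈ f '' A, e a = a)
    {g g' : σ → R.Bar f} (hg : ∀ s, (g' s).1 = e ∘ (g s).1) : Q g' ↔ Q g := by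
  obtain ⟨φ, -, h2⟩ := h
  rw [h2, h2, ← Language.StrongHomClass.realize_formula e φ (v := Sum.elim _ (coords g))]
  refine iff_of_eq (congrArg _ ?_)
  funext p
  rcases p with a | ⟨s, j⟩
  · exact (he _ ⟨a, a.2, rfl⟩).symm
  · exact congrFun (hg s) j

theorem eq (s t : σ) : Corr R f A (fun g => g s = g t) (fun g => g s = g t) := by
  refine ⟨Language.Formula.iInf fun j : Fin k =>
    (Language.Term.var (Sum.inr (s, j))).equal (Language.Term.var (Sum.inr (t, j))),
    fun g => ?_, fun g => ?_⟩ <;>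
  · beta_reduce
    rw [Language.Formula.realize_iInf, Subtype.ext_iff, funext_iff]
    refine forall_congr' fun j => ?_
    rw [Language.Formula.realize_equal]
    rfl

theorem eq_const (s : σ) (c : R.carrier) (hc : ∀ j, c.1 j ∈ A) :
    Corr R f A (fun g => g s = c) (fun g => g s = R.toBar f c) := by
  refine ⟨Language.Formula.iInf fun j : Fin k =>
    (Language.Term.var (Sum.inr (s, j))).equal (Language.Term.var (Sum.inl ⟨c.1 j, hc j⟩)),
    fun g => ?_, fun g => ?_⟩ <;>
  · beta_reduce
    rw [Language.Formula.realize_iInf, Subtype.ext_iff, funext_iff]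
    refine forall_congr' fun j => ?_
    rw [Language.Formula.realize_equal]
    rfl

theorem coords_fin_three {V : Type*} {C : Set (Fin k → V)} (g : Fin 3 → C) :
    coords g = cat3 (g 0).1 (g 1).1 (g 2).1 := by
  funext ⟨i, j⟩
  fin_cases i <;> rfl

theorem add_eq : Corr R f A (σ := Fin 3) (fun g => g 0 + g 1 = g 2) (fun g => g 0 + g 1 = g 2) := by
  obtain ⟨α, h1, h2⟩ := exists_formula f R.definable_add
  refine ⟨α.relabel Sum.inr, fun g => ?_, fun g => ?_⟩
  · rw [Language.Formula.realize_relabel, Sum.elim_comp_inr, ← h1, coords_fin_three]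
    refine Iff.trans ?_ (cat3_mem_graph (o := (· + ·))).symm
    exact ⟨fun h => ⟨(g 0).2, (g 1).2, congrArg _ h⟩, fun ⟨_, _, h⟩ => Subtype.ext h⟩
  · rw [Language.Formula.realize_relabel, Sum.elim_comp_inr, ← h2, coords_fin_three]
    exact ⟨fun h => h ▸ R.add_spec f _ _, R.eq_add f⟩

theorem mul_eq : Corr R f A (σ := Fin 3) (fun g => g 0 * g 1 = g 2) (fun g => g 0 * g 1 = g 2) := by
  obtain ⟨α, h1, h2⟩ := exists_formula f R.definable_mul
  refine ⟨α.relabel Sum.inr, fun g => ?_, fun g => ?_⟩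
  · rw [Language.Formula.realize_relabel, Sum.elim_comp_inr, ← h1, coords_fin_three]
    refine Iff.trans ?_ (cat3_mem_graph (o := (· * ·))).symm
    exact ⟨fun h => ⟨(g 0).2, (g 1).2, congrArg _ h⟩, fun ⟨_, _, h⟩ => Subtype.ext h⟩
  · rw [Language.Formula.realize_relabel, Sum.elim_comp_inr, ← h2, coords_fin_three]
    exact ⟨fun h => h ▸ R.mul_spec f _ _, R.eq_mul f⟩

/-- Only graphs are definable, so the value of each term is named by a new, existentially quantified
variable. -/
theorem subst [Finite τ] {P : (τ → R.carrier) → Prop} {Q : (τ → R.Bar f) → Prop}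
    (h : Corr R f A P Q) {t : τ → (σ → R.carrier) → R.carrier}
    {t' : τ → (σ → R.Bar f) → R.Bar f} (ht : ∀ i, CorrTerm R f A (t i) (t' i)) :
    Corr R f A (fun g => P fun i => t i g) (fun g => Q fun i => t' i g) := by
  have h1 : Corr R f A (σ := σ ⊕ τ) (fun g => ∀ i, g (Sum.inr i) = t i (g ∘ Sum.inl))
      (fun g => ∀ i, g (Sum.inr i) = t' i (g ∘ Sum.inl)) :=
    forall_index fun i => (ht i).reindex fun o => o.elim (Sum.inr i) Sum.inl
  refine (h1.and (h.reindex Sum.inr)).ex.congr (fun g => ?_) (fun g => ?_)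
  · simp only [Sum.elim_inr, Sum.elim_comp_inl, Sum.elim_comp_inr, ← funext_iff, exists_eq_left]
  · simp only [Sum.elim_inr, Sum.elim_comp_inl, Sum.elim_comp_inr, ← funext_iff, exists_eq_left]

end Corr

namespace CorrTerm

variable {t t₁ t₂ : (σ → R.carrier) → R.carrier} {t' t₁' t₂' : (σ → R.Bar f) → R.Bar f}

theorem var (s : σ) : CorrTerm R f A (fun g => g s) (fun g => g s) :=
  Corr.eq none (some s)

theorem reindex (h : CorrTerm R f A t t') (e : σ → τ) :
    CorrTerm R f A (fun g : τ → R.carrier => t (g ∘ e)) (fun g => t' (g ∘ e)) :=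
  Corr.reindex h (Option.map e)

theorem add (h₁ : CorrTerm R f A t₁ t₁') (h₂ : CorrTerm R f A t₂ t₂') :
    CorrTerm R f A (fun g => t₁ g + t₂ g) (fun g => t₁' g + t₂' g) := by
  have := Corr.subst (Corr.add_eq (R := R) (f := f) (A := A)) (σ := Option σ)
    (t := ![fun g => t₁ (g ∘ some), fun g => t₂ (g ∘ some), fun g => g none])
    (t' := ![fun g => t₁' (g ∘ some), fun g => t₂' (g ∘ some), fun g => g none])
    (Fin.cons (h₁.reindex some) (Fin.cons (h₂.reindex some)
      (Fin.cons (CorrTerm.var none) finZeroElim)))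
  exact this.congr (fun g => eq_comm) (fun g => eq_comm)

theorem mul (h₁ : CorrTerm R f A t₁ t₁') (h₂ : CorrTerm R f A t₂ t₂') :
    CorrTerm R f A (fun g => t₁ g * t₂ g) (fun g => t₁' g * t₂' g) := by
  have := Corr.subst (Corr.mul_eq (R := R) (f := f) (A := A)) (σ := Option σ)
    (t := ![fun g => t₁ (g ∘ some), fun g => t₂ (g ∘ some), fun g => g none])
    (t' := ![fun g => t₁' (g ∘ some), fun g => t₂' (g ∘ some), fun g => g none])
    (Fin.cons (h₁.reindex some) (Fin.cons (h₂.reindex some)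
      (Fin.cons (CorrTerm.var none) finZeroElim)))
  exact this.congr (fun g => eq_comm) (fun g => eq_comm)

theorem _root_.ModelRing.Corr.eqTerm (h₁ : CorrTerm R f A t₁ t₁') (h₂ : CorrTerm R f A t₂ t₂') :
    Corr R f A (fun g => t₁ g = t₂ g) (fun g => t₁' g = t₂' g) :=
  Corr.subst (Corr.eq (R := R) (f := f) (A := A) (0 : Fin 2) 1)
    (t := ![t₁, t₂]) (t' := ![t₁', t₂']) (Fin.cons h₁ (Fin.cons h₂ finZeroElim))

/-- The coordinates of 0 need not lie in A, so it is described without parameters, as the solution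
of z + z = z. Likewise 1 is described below as the neutral element of multiplication. -/
theorem zero : CorrTerm R f A (σ := σ) (fun _ => 0) (fun _ => 0) :=
  (Corr.eqTerm ((var (none : Option σ)).add (var none)) (var none)).congr
    (fun g => by simp) (fun g => by simp)

theorem one : CorrTerm R f A (σ := σ) (fun _ => 1) (fun _ => 1) := by
  refine (Corr.all (τ := Unit) (Corr.eqTerm ((var (Sum.inl (none : Option σ))).mul
    (var (Sum.inr ()))) (var (Sum.inr ())))).congr (fun g => ?_) (fun g => ?_)
  · simp only [Sum.elim_inl, Sum.elim_inr]
    exact ⟨fun h x => by rw [h, one_mul], fun h => by simpa using h fun _ => 1⟩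
  · simp only [Sum.elim_inl, Sum.elim_inr]
    exact ⟨fun h x => by rw [h, one_mul], fun h => by simpa using h fun _ => 1⟩

theorem neg (h : CorrTerm R f A t t') : CorrTerm R f A (fun g => -t g) (fun g => -t' g) :=
  (Corr.eqTerm ((var (none : Option σ)).add (h.reindex some)) zero).congr
    (fun _ => eq_neg_iff_add_eq_zero) (fun _ => eq_neg_iff_add_eq_zero)

theorem sub (h₁ : CorrTerm R f A t₁ t₁') (h₂ : CorrTerm R f A t₂ t₂') :
    CorrTerm R f A (fun g => t₁ g - t₂ g) (fun g => t₁' g - t₂' g) := by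
  simpa only [sub_eq_add_neg] using h₁.add h₂.neg

theorem sum {ι : Type} (s : Finset ι) {t : ι → (σ → R.carrier) → R.carrier}
    {t' : ι → (σ → R.Bar f) → R.Bar f} (h : ∀ i, CorrTerm R f A (t i) (t' i)) :
    CorrTerm R f A (fun g => ∑ i ∈ s, t i g) (fun g => ∑ i ∈ s, t' i g) := by
  classical
  induction s using Finset.induction_on with
  | empty => simpa using zero
  | insert a s ha ih =>
    simp only [Finset.sum_insert ha]
    exact (h a).add ih

theorem const (c : R.carrier) (hc : ∀ j, c.1 j ∈ A) :
    CorrTerm R f A (σ := σ) (fun _ => c) (fun _ => R.toBar f c) :=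
  Corr.eq_const none c hc

/-- This is where the position of the generators matters: all elements of the subring they generate
are definable over A, even if their own coordinates are not in A. -/
theorem exists_const {S : Set R.carrier} (hSA : ∀ s ∈ S, ∀ j : Fin k, s.1 j ∈ A) {d : R.carrier}
    (hd : d ∈ Subring.closure S) :
    ∃ d' : R.Bar f, CorrTerm R f A (σ := σ) (fun _ => d) (fun _ => d') := by
  induction hd using Subring.closure_induction with
  | mem x hx => exact ⟨_, const x (hSA x hx)⟩
  | zero => exact ⟨_, zero⟩
  | one => exact ⟨_, one⟩
  | add x y _ _ hx hy =>
    obtain ⟨⟨x', hx⟩, ⟨y', hy⟩⟩ := And.intro hx hy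
    exact ⟨_, hx.add hy⟩
  | neg x _ hx =>
    obtain ⟨x', hx⟩ := hx
    exact ⟨_, hx.neg⟩
  | mul x y _ _ hx hy =>
    obtain ⟨⟨x', hx⟩, ⟨y', hy⟩⟩ := And.intro hx hy
    exact ⟨_, hx.mul hy⟩

end CorrTerm

namespace Corr

theorem mem {D : Set R.carrier} (hD : IsDef L A D) (s : σ) :
    Corr R f A (fun g => g s ∈ D) (fun g => g s ∈ R.barSet f D) := by
  obtain ⟨φ, hφ⟩ := Set.definable_iff_exists_formula_sum.1 hD
  refine ⟨φ.relabel (Sum.map id fun j => (s, j)), fun g => ?_, fun g => ?_⟩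
  · beta_reduce
    rw [Language.Formula.realize_relabel, Sum.elim_comp_map,
      ← Subtype.val_injective.mem_set_image, hφ]
    rfl
  · have h := interp_eq f (φ.relabel (Sum.map Subtype.val id : A ⊕ Fin k → M ⊕ Fin k))
    simp only [Language.Formula.realize_relabel, Sum.elim_comp_map] at h
    beta_reduce
    rw [Language.Formula.realize_relabel, Sum.elim_comp_map]
    change (g s).1 ∈ interp f _ ↔ _
    rw [hφ]
    exact Set.ext_iff.1 h _

variable {P : (Unit → R.carrier) → Prop} {Q : (Unit → R.Bar f) → Prop}

theorem isDef (h : Corr R f A P Q) : IsDef L A {x : R.carrier | P fun _ => x} := by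
  obtain ⟨φ, h1, -⟩ := h
  have h3 : A.Definable L {x : Fin k → M |
      φ.Realize (Sum.elim Subtype.val fun p : Unit × Fin k => x p.2)} :=
    Set.definable_iff_exists_formula_sum.2 ⟨φ.relabel (Sum.map id Prod.snd), by
      simp only [Language.Formula.realize_relabel, Sum.elim_comp_map]
      rfl⟩
  refine (congrArg (A.Definable L) ?_).mp ((R.definable_carrier.mono (Set.empty_subset A)).inter h3)
  ext x
  constructor
  · rintro ⟨hx, h⟩
    exact ⟨⟨x, hx⟩, (h1 _).2 h, rfl⟩
  · rintro ⟨x, hx, rfl⟩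
    exact ⟨x.2, (h1 _).1 hx⟩

theorem isDef_bar (h : Corr R f A P Q) : IsDef L (f '' A) {x : R.Bar f | Q fun _ => x} := by
  obtain ⟨φ, -, h2⟩ := h
  obtain ⟨δ, -, hδ⟩ := exists_formula f R.definable_carrier
  have h3 : (f '' A).Definable L {x : Fin k → N |
      φ.Realize (Sum.elim (fun a : A => f a) fun p : Unit × Fin k => x p.2)} :=
    Set.definable_iff_exists_formula_sum.2
      ⟨φ.relabel (Sum.map (fun a : A => (⟨f a, a, a.2, rfl⟩ : (f '' A : Set N))) Prod.snd), by
        simp only [Language.Formula.realize_relabel, Sum.elim_comp_map]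
        rfl⟩
  have h4 : (f '' A).Definable L (interp f R.carrier) :=
    (Set.empty_definable_iff.2 ⟨δ, Set.ext hδ⟩).mono (Set.empty_subset _)
  refine (congrArg ((f '' A).Definable L) ?_).mp (h4.inter h3)
  ext x
  constructor
  · rintro ⟨hx, h⟩
    exact ⟨⟨x, hx⟩, (h2 _).2 h, rfl⟩
  · rintro ⟨x, hx, rfl⟩
    exact ⟨x.2, (h2 _).1 hx⟩

theorem exists_of_isDef {E : Set (R.Bar f)} (hE : IsDef L (f '' A) E) :
    ∃ D : Set R.carrier, Corr R f A (σ := Unit) (fun g => g () ∈ D) (fun g => g () ∈ E) := by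
  obtain ⟨φ, hφ⟩ := Set.definable_iff_exists_formula_sum.1 hE
  choose p hp using fun b : f '' A => b.2
  let ψ : L.Formula (A ⊕ Unit × Fin k) :=
    φ.relabel (Sum.map (fun b => ⟨p b, (hp b).1⟩) fun j => ((), j))
  refine ⟨{x | ψ.Realize (Sum.elim Subtype.val (coords fun _ => x))}, ψ, fun g => Iff.rfl,
    fun g => ?_⟩
  beta_reduce
  rw [Language.Formula.realize_relabel, Sum.elim_comp_map,
      ← Subtype.val_injective.mem_set_image, hφ]
  rw [show (fun a : A => f a) ∘ (fun b => ⟨p b, (hp b).1⟩) = (Subtype.val : f '' A → N) from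
    funext fun b => (hp b).2]
  rfl

end Corr

end Correspondence

/-! ### Compactness in the monster model for relations between tuples -/

section Saturation

variable {L : FirstOrder.Language.{u, v}} {N : Type w'} [L.Structure N] {κ : Cardinal.{w'}}

theorem IsMonster.mk_union_range_lt (hN : IsMonster L N κ) {B : Set N} (hB : #B < κ) {ι : Type}
    [Finite ι] (a : ι → N) : #(B ∪ Set.range a : Set N) < κ :=
  (mk_union_le _ _).trans_lt (add_lt_of_lt hN.aleph0_lt.le hB
    ((Set.finite_range a).lt_aleph0.trans hN.aleph0_lt))

/-- Saturation is given for one variable only. The projection of the ultrafilter realizes the first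
n coordinates; they then join the parameters, and the last coordinate realizes a type in one
variable. -/
theorem IsMonster.exists_realize_ultrafilter (hN : IsMonster L N κ) {B : Set N} (hB : #B < κ)
    (n : ℕ) (U : Ultrafilter (Fin n → N)) :
    ∃ a : Fin n → N, ∀ φ : L.Formula (B ⊕ Fin n),
      {v : Fin n → N | φ.Realize (Sum.elim Subtype.val v)} ∈ U →
        φ.Realize (Sum.elim Subtype.val a) := by
  induction n with
  | zero =>
    refine ⟨finZeroElim, fun φ hφ => ?_⟩
    obtain ⟨v, hv⟩ := U.nonempty_of_mem hφ
    rwa [Subsingleton.elim finZeroElim v]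
  | succ n ih =>
    obtain ⟨a, ha⟩ := ih (U.map Fin.init)
    have hB' := hN.mk_union_range_lt hB a
    set B' : Set N := B ∪ Set.range a
    let e : B ⊕ Fin (n + 1) → B' ⊕ Unit :=
      Sum.elim (fun b => Sum.inl ⟨b, Or.inl b.2⟩)
        (Fin.snoc (α := fun _ => B' ⊕ Unit) (fun i => Sum.inl ⟨a i, Or.inr ⟨i, rfl⟩⟩)
          (Sum.inr ()))
    have he : ∀ (φ : L.Formula (B ⊕ Fin (n + 1))) (x : N),
        (φ.relabel e).Realize (Sum.elim Subtype.val fun _ => x) ↔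
          φ.Realize (Sum.elim Subtype.val (Fin.snoc (α := fun _ => N) a x)) := by
      intro φ x
      rw [Language.Formula.realize_relabel]
      refine iff_of_eq (congrArg _ ?_)
      funext p
      rcases p with b | i
      · rfl
      · refine Fin.lastCases ?_ (fun i => ?_) i <;> simp [e]
    obtain ⟨x, hx⟩ := hN.saturated B' hB' {ψ | ∃ φ : L.Formula (B ⊕ Fin (n + 1)),
        {v : Fin (n + 1) → N | φ.Realize (Sum.elim Subtype.val v)} ∈ U ∧ ψ = φ.relabel e} (by
      intro q hq
      choose φ hφU hφ using fun ψ : q => hq ψ.2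
      let Φ : L.Formula (B ⊕ Fin (n + 1)) := Language.Formula.iInf φ
      have hΦ : {v : Fin (n + 1) → N | Φ.Realize (Sum.elim Subtype.val v)} ∈ U := by
        simp only [Φ, Language.Formula.realize_iInf]
        have := (Filter.iInter_mem (f := (U : Filter (Fin (n + 1) → N)))).2 hφU
        refine Filter.mem_of_superset this fun v hv => ?_
        simpa using hv
      let r : B ⊕ Fin (n + 1) → (B ⊕ Fin n) ⊕ Unit :=
        Sum.elim (fun b => Sum.inl (Sum.inl b))
          (Fin.snoc (α := fun _ => (B ⊕ Fin n) ⊕ Unit) (fun i => Sum.inl (Sum.inr i))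
            (Sum.inr ()))
      have hr : ∀ (v : Fin n → N) (y : Unit → N),
          Sum.elim (Sum.elim Subtype.val v) y ∘ r =
            Sum.elim Subtype.val (Fin.snoc (α := fun _ => N) v (y ())) := by
        intro v y
        funext p
        rcases p with b | i
        · rfl
        · refine Fin.lastCases ?_ (fun i => ?_) i <;> simp [r]
      -- The formula "some y satisfies Φ" lies in the projected type, hence holds at a; this is
      -- finite satisfiability.
      have key := ha (Language.Formula.iExs Unit (Φ.relabel r)) (by
        refine Ultrafilter.mem_map.2 ?_
        refine Filter.mem_of_superset hΦ fun v hv => ?_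
        rw [Set.mem_preimage, Set.mem_ofPred_eq, Language.Formula.realize_iExs]
        refine ⟨fun _ => v (Fin.last n), ?_⟩
        rw [Language.Formula.realize_relabel]
        change Φ.Realize (Sum.elim (Sum.elim _ _) _ ∘ r)
        rw [hr, Fin.snoc_init_self]
        exact hv)
      rw [Language.Formula.realize_iExs] at key
      obtain ⟨y, hy⟩ := key
      rw [Language.Formula.realize_relabel] at hy
      change Φ.Realize (Sum.elim (Sum.elim _ _) _ ∘ r) at hy
      rw [hr, Language.Formula.realize_iInf] at hy
      refine ⟨y (), fun ψ hψ => ?_⟩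
      have h1 := hφ ⟨ψ, hψ⟩
      rw [show ψ = (φ ⟨ψ, hψ⟩).relabel e from h1, he]
      exact hy _)
    exact ⟨Fin.snoc (α := fun _ => N) a x, fun φ hφ => (he φ x).1 (hx _ ⟨φ, hφ, rfl⟩)⟩

variable {k : ℕ} {C : Set (Fin k → N)} {σ : Type}

/-- A relation between elements of a set `C` of tuples is definable over `B`. -/
def DefRel (L : FirstOrder.Language.{u, v}) {N : Type w'} [L.Structure N] {k : ℕ}
    {C : Set (Fin k → N)} (B : Set N) {σ : Type} (S : Set (σ → C)) : Prop :=
  ∃ φ : L.Formula (B ⊕ (σ × Fin k)), ∀ g, g ∈ S ↔ φ.Realize (Sum.elim Subtype.val (coords g))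

/-- Compactness: a family of relations that are definable over a small set of parameters has
a common element, if every finite subfamily has one. -/
theorem IsMonster.iInter_nonempty (hN : IsMonster L N κ) {B : Set N} (hB : #B < κ)
    (hC : (∅ : Set N).Definable L C) [Finite σ] {ι : Type*} {S : ι → Set (σ → C)}
    (hS : ∀ i, DefRel L B (S i)) (hfin : ∀ t : Finset ι, (⋂ i ∈ t, S i).Nonempty) :
    (⋂ i, S i).Nonempty := by
  choose φ hφ using hS
  obtain ⟨δ, hδ⟩ := Set.empty_definable_iff.1 hC
  have hne : (⨅ t : Finset ι, Filter.principal (⋂ i ∈ t, S i)).NeBot := by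
    classical
    refine Filter.iInf_neBot_of_directed' (fun t₁ t₂ => ⟨t₁ ∪ t₂, ?_, ?_⟩) (fun t =>
      Filter.principal_neBot_iff.2 (hfin t))
    · exact Filter.principal_mono.2 (Set.biInter_mono (fun i hi => Finset.mem_union_left _ hi)
        fun _ _ => le_rfl)
    · exact Filter.principal_mono.2 (Set.biInter_mono (fun i hi => Finset.mem_union_right _ hi)
        fun _ _ => le_rfl)
  let U := Ultrafilter.of (⨅ t : Finset ι, Filter.principal (⋂ i ∈ t, S i))
  have hU : ∀ i, S i ∈ U := fun i => by
    refine Ultrafilter.of_le _ (Filter.mem_iInf_of_mem {i} ?_)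
    simp
  obtain ⟨n, ⟨e⟩⟩ := Finite.exists_equiv_fin (σ × Fin k)
  obtain ⟨a, ha⟩ := hN.exists_realize_ultrafilter hB n (U.map fun g => coords g ∘ e.symm)
  -- The formula δ of C holds at the coordinates of every g, so it belongs to the type and the
  -- realization stays in C.
  have hmem : ∀ s, (fun j => a (e (s, j))) ∈ C := by
    intro s
    have := ha (δ.relabel fun j => Sum.inr (e (s, j))) (by
      refine Ultrafilter.mem_map.2 ?_
      refine Filter.mem_of_superset Filter.univ_mem fun g _ => ?_
      rw [Set.mem_preimage, Set.mem_ofPred_eq, Language.Formula.realize_relabel]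
      have h2 : δ.Realize (g s).1 := (Set.ext_iff.1 hδ _).1 (g s).2
      refine cast (congrArg _ ?_) h2
      funext j
      simp [coords])
    rw [Language.Formula.realize_relabel] at this
    rw [hδ]
    exact this
  refine ⟨fun s => ⟨_, hmem s⟩, Set.mem_iInter.2 fun i => (hφ i _).2 ?_⟩
  have := ha ((φ i).relabel (Sum.map id e)) (by
    refine Ultrafilter.mem_map.2 ?_
    refine Filter.mem_of_superset (hU i) fun g hg => ?_
    rw [Set.mem_preimage, Set.mem_ofPred_eq, Language.Formula.realize_relabel]
    refine cast (congrArg _ ?_) ((hφ i g).1 hg)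
    funext p
    rcases p with b | p <;> simp)
  rw [Language.Formula.realize_relabel, Sum.elim_comp_map] at this
  exact this

namespace DefRel

variable {B : Set N}

theorem iff_formula (φ : L.Formula (B ⊕ Fin k)) (s t : σ) :
    DefRel L B {g : σ → C | φ.Realize (Sum.elim Subtype.val (g s).1) ↔
      φ.Realize (Sum.elim Subtype.val (g t).1)} := by
  refine ⟨(φ.relabel (Sum.map id fun j => (s, j))).iff (φ.relabel (Sum.map id fun j => (t, j))),
    fun g => ?_⟩
  rw [Language.Formula.realize_iff, Language.Formula.realize_relabel,
    Language.Formula.realize_relabel, Sum.elim_comp_map, Sum.elim_comp_map]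
  rfl

theorem of_corr {M : Type w} [L.Structure M] {R : DefinableCommRing L M k} {f : M ↪ₑ[L] N}
    {A : Set M} {τ : Type} {P : (σ ⊕ τ → R.carrier) → Prop} {Q : (σ ⊕ τ → R.Bar f) → Prop}
    (h : Corr R f A P Q) (hAB : f '' A ⊆ B) (c : τ → R.Bar f) (hc : ∀ t j, (c t).1 j ∈ B) :
    DefRel L B {g : σ → R.Bar f | Q (Sum.elim g c)} := by
  obtain ⟨φ, -, h⟩ := h
  refine ⟨φ.relabel (Sum.elim (fun a : A => Sum.inl ⟨f a, hAB ⟨a, a.2, rfl⟩⟩) fun p : (σ ⊕ τ) × Fin k =>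
    Sum.elim (fun s => Sum.inr (s, p.2)) (fun t => Sum.inl ⟨_, hc t p.2⟩) p.1), fun g => ?_⟩
  rw [Set.mem_ofPred_eq, h, Language.Formula.realize_relabel]
  refine iff_of_eq (congrArg _ ?_)
  funext p
  rcases p with a | ⟨s | t, j⟩ <;> rfl

theorem of_corr' {M : Type w} [L.Structure M] {R : DefinableCommRing L M k} {f : M ↪ₑ[L] N}
    {A : Set M} {P : (σ → R.carrier) → Prop} {Q : (σ → R.Bar f) → Prop}
    (h : Corr R f A P Q) (hAB : f '' A ⊆ B) : DefRel L B {g : σ → R.Bar f | Q g} :=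
  of_corr (h.reindex (Sum.inl : σ → σ ⊕ Empty)) hAB Empty.elim fun t => t.elim

end DefRel

end Saturation

/-! ### Differences of elements of equal type, bounded index and thickness -/

section BoundedIndex

open DefinableCommRing

variable {L : FirstOrder.Language.{u, v}} {M : Type w} {N : Type w'} [L.Structure M] [L.Structure N]
  {κ : Cardinal.{w'}} {k : ℕ}

/-- Two tuples have the same type over `B`. -/
def SameType (L : FirstOrder.Language.{u, v}) {N : Type w'} [L.Structure N] (B : Set N) {k : ℕ}
    (a b : Fin k → N) : Prop :=
  ∀ φ : L.Formula (B ⊕ Fin k),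
    φ.Realize (Sum.elim Subtype.val a) ↔ φ.Realize (Sum.elim Subtype.val b)

theorem SameType.symm {B : Set N} {a b : Fin k → N} (h : SameType L B a b) : SameType L B b a :=
  fun φ => (h φ).symm

theorem SameType.exists_equiv (hN : IsMonster L N κ) {B : Set N} (hB : #B < κ) {a b : Fin k → N}
    (h : SameType L B a b) : ∃ e : N ≃[L] N, (∀ x ∈ B, e x = x) ∧ e ∘ a = b := by
  have hex : ∀ x : (B ∪ Set.range a : Set N), ∃ p : B ⊕ Fin k, Sum.elim Subtype.val a p = x.1 := by
    rintro ⟨x, hx | ⟨i, rfl⟩⟩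
    · exact ⟨Sum.inl ⟨x, hx⟩, rfl⟩
    · exact ⟨Sum.inr i, rfl⟩
  choose p hp using hex
  -- An element may have several names in B and a. Equal types contain the same equations, so the
  -- map that fixes B and sends a to b does not depend on the name.
  have heq : ∀ q q' : B ⊕ Fin k, Sum.elim Subtype.val a q = Sum.elim Subtype.val a q' →
      Sum.elim Subtype.val b q = Sum.elim Subtype.val b q' := by
    intro q q' hq
    have := (h ((Language.Term.var q).equal (Language.Term.var q'))).1
    rw [Language.Formula.realize_equal, Language.Formula.realize_equal] at this
    exact this hq
  obtain ⟨e, he⟩ := hN.homogeneous _ (hN.mk_union_range_lt hB a)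
    (fun x => Sum.elim Subtype.val b (p x)) (fun φ => by
      have := h (φ.relabel p)
      rw [Language.Formula.realize_relabel, Language.Formula.realize_relabel] at this
      rw [show (Subtype.val : (B ∪ Set.range a : Set N) → N) = Sum.elim Subtype.val a ∘ p from
        funext fun x => (hp x).symm]
      exact this)
  refine ⟨e, fun x hx => ?_, funext fun i => ?_⟩
  · rw [he ⟨x, Or.inl hx⟩]
    exact heq _ (Sum.inl ⟨x, hx⟩) (hp _)
  · rw [Function.comp_apply, he ⟨a i, Or.inr ⟨i, rfl⟩⟩]
    exact heq _ (Sum.inr i) (hp _)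

variable (R : DefinableCommRing L M k) (f : M ↪ₑ[L] N) (A : Set M)

/-- The differences of elements with the same type over `B`. -/
def sameTypeDiff (B : Set N) : Set (R.Bar f) :=
  {x | ∃ a b : R.Bar f, SameType L B a.1 b.1 ∧ x = -a + b}

variable {R f A}

theorem neg_mem_sameTypeDiff {B : Set N} {x : R.Bar f} (hx : x ∈ sameTypeDiff R f B) :
    -x ∈ sameTypeDiff R f B := by
  obtain ⟨a, b, h, rfl⟩ := hx
  exact ⟨b, a, h.symm, by abel⟩

theorem corr_neg_add : Corr R f A (σ := Fin 3) (fun g => -g 0 + g 1 = g 2)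
    (fun g => -g 0 + g 1 = g 2) :=
  Corr.eqTerm ((CorrTerm.var 0).neg.add (CorrTerm.var 1)) (CorrTerm.var 2)

/-- An invariant subgroup of bounded index contains all differences of elements with the same
type over a certain small set. -/
theorem exists_sameTypeDiff_subset (hN : IsMonster L N κ) (hA : #(f '' A) < κ)
    {H : AddSubgroup (R.Bar f)} (hinv : IsInv L (f '' A) (H : Set (R.Bar f)))
    (hH : #(R.Bar f ⧸ H) < κ) :
    ∃ B : Set N, f '' A ⊆ B ∧ #B < κ ∧ sameTypeDiff R f B ⊆ H := by
  -- The small set consists of A and the coordinates of one representative of each coset of H.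
  let c : (R.Bar f ⧸ H) × Fin k → N := fun p => p.1.out.1 p.2
  have hB : #(f '' A ∪ Set.range c : Set N) < κ := by
    refine (mk_union_le _ _).trans_lt (add_lt_of_lt hN.aleph0_lt.le hA (mk_range_le.trans_lt ?_))
    rw [mk_prod, lift_uzero, mk_fin, lift_natCast]
    exact mul_lt_of_lt hN.aleph0_lt.le hH (natCast_lt_aleph0.trans hN.aleph0_lt)
  refine ⟨_, Set.subset_union_left, hB, ?_⟩
  rintro _ ⟨a, b, hab, rfl⟩
  obtain ⟨e, he, hea⟩ := hab.exists_equiv hN hB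
  let r : R.Bar f := (QuotientAddGroup.mk a : R.Bar f ⧸ H).out
  have hr : -r + a ∈ H := QuotientAddGroup.eq.1 (Quotient.out_eq _)
  obtain ⟨y, hy, hye⟩ := hinv e (fun x hx => he x (Or.inl hx)) _ ⟨_, hr, rfl⟩
  have hr' : e ∘ r.1 = r.1 := funext fun j => he _ (Or.inr ⟨(QuotientAddGroup.mk a, j), rfl⟩)
  -- The automorphism fixes the representative r and moves a to b, so it moves -r + a, an element of
  -- H, to -r + b.
  have := (corr_neg_add.invariant e (fun x hx => he x (Or.inl hx)) (g := ![r, a, -r + a])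
    (g' := ![r, b, y]) (Fin.cons hr'.symm (Fin.cons hea.symm (Fin.cons hye finZeroElim)))).2 rfl
  have h2 : -r + b ∈ H := by
    rw [show -r + b = y from this]
    exact hy
  have h3 := H.add_mem (H.neg_mem hr) h2
  rwa [show -(-r + a) + (-r + b) = -a + b by abel] at h3

theorem definable_interp_carrier (R : DefinableCommRing L M k) (f : M ↪ₑ[L] N) (B : Set N) :
    B.Definable L (interp f R.carrier) := by
  obtain ⟨δ, -, hδ⟩ := exists_formula f R.definable_carrier
  exact (Set.empty_definable_iff.2 ⟨δ, Set.ext hδ⟩).mono (Set.empty_subset _)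

/-- By compactness, agreement on a finite set Δ of formulas over B already puts the difference in E.
The pigeonhole principle on truth values bounds the size of a family without such a pair. For that
fixed size the statement is first-order over A, so it descends to R although B lies in the large
model. -/
theorem isThick_of_sameTypeDiff_subset_of_neg (hN : IsMonster L N κ) {B : Set N} (hB : #B < κ)
    (hAB : f '' A ⊆ B) {D : Set R.carrier} {E : Set (R.Bar f)}
    (hD : Corr R f A (σ := Unit) (fun g => g () ∈ D) (fun g => g () ∈ E))
    (hneg : ∀ x ∈ D, -x ∈ D) (hBD : sameTypeDiff R f B ⊆ E) : IsThick D := by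
  have h1 : ∃ Δ : Finset (L.Formula (B ⊕ Fin k)), ∀ a b : R.Bar f,
      (∀ φ ∈ Δ, φ.Realize (Sum.elim Subtype.val a.1) ↔ φ.Realize (Sum.elim Subtype.val b.1)) →
        -a + b ∈ E := by
    by_contra! hcon
    obtain ⟨g, hg⟩ := hN.iInter_nonempty hB (definable_interp_carrier R f ∅) (σ := Fin 2)
      (S := fun o : Option (L.Formula (B ⊕ Fin k)) => o.elim {g | ¬ -g 0 + g 1 ∈ E}
        fun φ => {g | φ.Realize (Sum.elim Subtype.val (g 0).1) ↔
          φ.Realize (Sum.elim Subtype.val (g 1).1)})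
      (by
        rintro (_ | φ)
        · exact DefRel.of_corr' (Corr.subst hD
            (fun _ => (CorrTerm.var (0 : Fin 2)).neg.add (CorrTerm.var 1))).not hAB
        · exact DefRel.iff_formula φ 0 1)
      (fun t => by
        obtain ⟨a, b, hab, hE⟩ := hcon t.eraseNone
        refine ⟨![a, b], Set.mem_iInter₂.2 ?_⟩
        rintro (_ | φ) hφ
        · exact hE
        · exact hab φ (Finset.mem_eraseNone.2 hφ))
    rw [Set.mem_iInter] at hg
    exact hg none (hBD ⟨g 0, g 1, fun φ => hg (some φ), rfl⟩)
  obtain ⟨Δ, hΔ⟩ := h1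
  classical
  -- One more than the number of truth assignments on Δ, so two elements must agree on Δ.
  refine ⟨hneg, Fintype.card (Δ → Prop) + 1, Nat.succ_pos _, ?_⟩
  have hcorr : Corr R f A (σ := Fin (Fintype.card (Δ → Prop) + 1))
      (fun g => ∃ i j, i < j ∧ -g i + g j ∈ D) (fun g => ∃ i j, i < j ∧ -g i + g j ∈ E) := by
    refine Corr.exists_index fun i => Corr.exists_index fun j => ?_
    by_cases hij : i < j
    · simpa [hij] using Corr.subst hD fun _ => (CorrTerm.var i).neg.add (CorrTerm.var j)
    -- For i ≥ j the clause is false; the negation of `g i = g i` expresses this.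
    · simpa [hij] using (Corr.eq (R := R) (f := f) (A := A) i i).not
  refine hcorr.transfer_forall.2 fun g => ?_
  obtain ⟨i, j, hij, h⟩ := Fintype.exists_ne_map_eq_of_card_lt
    (fun i => fun φ : Δ => φ.1.Realize (Sum.elim Subtype.val (g i).1)) (by simp)
  have h' : ∀ φ ∈ Δ, φ.Realize (Sum.elim Subtype.val (g i).1) ↔
      φ.Realize (Sum.elim Subtype.val (g j).1) := fun φ hφ => iff_of_eq (congrFun h ⟨φ, hφ⟩)
  rcases lt_or_gt_of_ne hij with hlt | hlt
  · exact ⟨i, j, hlt, hΔ _ _ h'⟩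
  · exact ⟨j, i, hlt, hΔ _ _ fun φ hφ => (h' φ hφ).symm⟩

theorem isThick_of_sameTypeDiff_subset (hN : IsMonster L N κ) {B : Set N} (hB : #B < κ)
    (hAB : f '' A ⊆ B) {D : Set R.carrier} {E : Set (R.Bar f)}
    (hD : Corr R f A (σ := Unit) (fun g => g () ∈ D) (fun g => g () ∈ E))
    (hBD : sameTypeDiff R f B ⊆ E) : IsThick {x | x ∈ D ∧ -x ∈ D} :=
  isThick_of_sameTypeDiff_subset_of_neg hN hB hAB (E := {x | x ∈ E ∧ -x ∈ E})
    (hD.and (Corr.subst hD fun _ => (CorrTerm.var ()).neg))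
    (fun x hx => ⟨hx.2, by rw [neg_neg]; exact hx.1⟩)
    (fun _ hx => ⟨hBD hx, hBD (neg_mem_sameTypeDiff hx)⟩)

section Ideals

variable {m : ℕ} {S : Set R.carrier} (hSA : ∀ s ∈ S, ∀ j : Fin k, s.1 j ∈ A)
  (hgen : Subring.closure S = ⊤)
include hSA hgen

/-- Ideals generated by finitely many elements correspond to each other. -/
theorem exists_corr_span (f : M ↪ₑ[L] N) (d : Fin m → R.carrier) : ∃ d' : Fin m → R.Bar f,
    (∀ i, CorrTerm R f A (σ := Empty) (fun _ => d i) (fun _ => d' i)) ∧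
    Corr R f A (σ := Unit) (fun g => g () ∈ Ideal.span (Set.range d))
      (fun g => g () ∈ Ideal.span (Set.range d')) := by
  choose d' hd' using fun i => CorrTerm.exists_const (σ := Empty) (f := f) hSA
    (hgen ▸ Subring.mem_top (d i))
  refine ⟨d', hd', ?_⟩
  refine (Corr.ex (τ := Fin m) (Corr.eqTerm (CorrTerm.sum Finset.univ fun i =>
    (CorrTerm.var (Sum.inr i)).mul ((hd' i).reindex Empty.elim))
      (CorrTerm.var (Sum.inl ())))).congr (fun g => ?_) (fun g => ?_)
  · rw [Ideal.mem_span_range_iff_exists_fun]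
    rfl
  · rw [Ideal.mem_span_range_iff_exists_fun]
    rfl

theorem isDef_span (f : M ↪ₑ[L] N) (d : Fin m → R.carrier) :
    IsDef L A (Ideal.span (Set.range d) : Set R.carrier) := by
  obtain ⟨d', -, h⟩ := exists_corr_span hSA hgen f d
  exact h.isDef

end Ideals

/-- For a fixed number p, the existence of p elements that meet all cosets is a first-order
statement. -/
theorem finite_quotient_of_corr {I : Ideal R.carrier} {I' : Ideal (R.Bar f)}
    (h : Corr R f A (σ := Unit) (fun g => g () ∈ I) (fun g => g () ∈ I'))
    (hI : Finite (R.carrier ⧸ I)) : Finite (R.Bar f ⧸ I') := by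
  obtain ⟨p, ⟨e⟩⟩ := Finite.exists_equiv_fin (R.carrier ⧸ I)
  have hc : Corr R f A (σ := Fin p) (fun c => ∀ x : Unit → R.carrier, ∃ i, x () - c i ∈ I)
      (fun c => ∀ x : Unit → R.Bar f, ∃ i, x () - c i ∈ I') :=
    Corr.all (Corr.exists_index fun i => Corr.subst h fun _ =>
      (CorrTerm.var (Sum.inr ())).sub (CorrTerm.var (Sum.inl i)))
  obtain ⟨c, hc⟩ := hc.transfer_exists.1 ⟨fun i => (e.symm i).out, fun x =>
    ⟨e (Ideal.Quotient.mk I (x ())), by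
      rw [← Ideal.Quotient.eq, Ideal.Quotient.mk_out, Equiv.symm_apply_apply]⟩⟩
  refine Finite.of_surjective (fun i => Ideal.Quotient.mk I' (c i)) fun x => ?_
  obtain ⟨x, rfl⟩ := Ideal.Quotient.mk_surjective x
  obtain ⟨i, hi⟩ := hc fun _ => x
  exact ⟨i, (Ideal.Quotient.eq.2 hi).symm⟩

theorem isDef_of_definable {B : Set N} {T : Set (Fin k → N)} (hT : B.Definable L T) :
    IsDef L B {y : R.Bar f | y.1 ∈ T} := by
  refine (congrArg (B.Definable L) ?_).mp ((definable_interp_carrier R f B).inter hT)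
  ext x
  constructor
  · rintro ⟨hx, h⟩
    exact ⟨⟨x, hx⟩, h, rfl⟩
  · rintro ⟨x, hx, rfl⟩
    exact ⟨x.2, hx⟩

end BoundedIndex

/-! ### Connected components as sums of multiples -/

section MainArgument

open DefinableCommRing

variable {L : FirstOrder.Language.{u, v}} {M : Type w} {N : Type w'} [L.Structure M] [L.Structure N]
  {κ : Cardinal.{w'}} {k : ℕ} {R : DefinableCommRing L M k} {f : M ↪ₑ[L] N} {A : Set M}

/-- If the symmetric part of every definable set that contains a type-definable set `Y` is thick,
then the sum of multiples of `Y` contains the connected component. -/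
theorem comp0_subset_nfoldSum (hN : IsMonster L N κ) (hA : #(f '' A) < κ) {m : ℕ}
    {S : Set R.carrier} (hSA : ∀ s ∈ S, ∀ j : Fin k, s.1 j ∈ A) (hgen : Subring.closure S = ⊤)
    (hgenThick : ∀ D : Set R.carrier, IsThick D → ∃ d : Fin m → R.carrier, (∀ i, d i ∈ D) ∧
      Finite (R.carrier ⧸ Ideal.span (Set.range d)))
    {Y : Set (R.Bar f)} (hY : IsTypeDef L (f '' A) Y)
    (hthick : ∀ (D : Set R.carrier) (E : Set (R.Bar f)),
      Corr R f A (σ := Unit) (fun g => g () ∈ D) (fun g => g () ∈ E) → Y ⊆ E →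
      IsThick {x | x ∈ D ∧ -x ∈ D}) :
    (R.comp0 f A : Set (R.Bar f)) ⊆ nfoldSum m (Side.left.mulSet Y) := by
  intro x hx
  obtain ⟨F, hF, hYF⟩ := hY
  have hYmem : ∀ y : R.Bar f, y ∈ Y ↔ ∀ T : F, y.1 ∈ T.1 := by
    intro y
    rw [← Subtype.val_injective.mem_set_image, hYF, Set.mem_sInter]
    exact ⟨fun h T => h T.1 T.2, fun h T hT => h ⟨T, hT⟩⟩
  choose D hD using fun T : F => Corr.exists_of_isDef (isDef_of_definable (R := R) (f := f)
    (hF T.1 T.2))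
  obtain ⟨g, hg⟩ := hN.iInter_nonempty (hN.mk_union_range_lt hA x.1)
    (definable_interp_carrier R f ∅) (σ := Fin m ⊕ Fin m)
    -- A type in 2m variables, coefficients and elements of Y: `none` demands the sum x, and `some
    -- (T, i)` puts the i-th element into T.
    (S := fun o : Option (F × Fin m) => o.elim {g | ∑ i, g (Sum.inl i) * g (Sum.inr i) = x}
      fun p => {g | (g (Sum.inr p.2)).1 ∈ p.1.1})
    (by
      rintro (_ | ⟨T, i⟩)
      · exact DefRel.of_corr (τ := Unit) (Corr.eqTerm (CorrTerm.sum Finset.univ fun i =>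
          (CorrTerm.var (Sum.inl (Sum.inl i))).mul (CorrTerm.var (Sum.inl (Sum.inr i))))
          (CorrTerm.var (Sum.inr ()))) Set.subset_union_left (fun _ => x)
          fun _ j => Or.inr ⟨j, rfl⟩
      · exact DefRel.of_corr' ((hD T).reindex fun _ => Sum.inr i) Set.subset_union_left)
    (fun t => by
      have hcorr : Corr R f A (σ := Unit) (fun g => ∀ p : t.eraseNone, g () ∈ D p.1.1)
          (fun g => ∀ p : t.eraseNone, (g ()).1 ∈ p.1.1.1) :=
        Corr.forall_index fun p => hD p.1.1
      obtain ⟨d, hd, hfin⟩ := hgenThick _ (hthick {x | ∀ p : t.eraseNone, x ∈ D p.1.1}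
        {y | ∀ p : t.eraseNone, y.1 ∈ p.1.1.1} hcorr fun y hy p => (hYmem y).1 hy p.1.1)
      obtain ⟨d', hdd', hspan⟩ := exists_corr_span hSA hgen f d
      -- The ideal generated by the d' i is A-definable of finite index in the monster model, so it
      -- contains the component and in particular x.
      have hx' : x ∈ Ideal.span (Set.range d') :=
        Ideal.mem_sInf.1 hx ⟨hspan.isDef_bar, finite_quotient_of_corr hspan hfin⟩
      obtain ⟨r, hr⟩ := Ideal.mem_span_range_iff_exists_fun.1 hx'
      refine ⟨Sum.elim r d', Set.mem_iInter₂.2 ?_⟩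
      rintro (_ | ⟨T, i⟩) hp
      · exact hr
      · exact (Corr.subst hcorr fun _ => hdd' i).transfer_forall.1 (fun _ => (hd i).1)
          Empty.elim ⟨(T, i), Finset.mem_eraseNone.2 hp⟩)
  rw [Set.mem_iInter] at hg
  have hnone : ∑ i, g (Sum.inl i) * g (Sum.inr i) = x := hg none
  exact ⟨fun i => g (Sum.inl i) * g (Sum.inr i), fun i => ⟨_, g (Sum.inr i), (hYmem _).2 fun T =>
    hg (some (T, i)), rfl⟩, hnone.symm⟩

theorem IsTypeDef.top : IsTypeDef L (f '' A) ((⊤ : AddSubgroup (R.Bar f)) : Set (R.Bar f)) :=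
  ⟨{interp f R.carrier}, by
    rintro _ rfl
    exact definable_interp_carrier R f _, by simp⟩

theorem IsTypeDef.inter {X Y : Set (R.Bar f)} (hX : IsTypeDef L (f '' A) X)
    (hY : IsTypeDef L (f '' A) Y) : IsTypeDef L (f '' A) (X ∩ Y) := by
  obtain ⟨F, hF, hXF⟩ := hX
  obtain ⟨G, hG, hYG⟩ := hY
  refine ⟨F ∪ G, fun T hT => hT.elim (hF T) (hG T), ?_⟩
  rw [Set.image_inter Subtype.val_injective, hXF, hYG, Set.sInter_union]

/-- Taking all A-definable supersets of the intersection avoids choosing a defining family for each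
member. -/
theorem IsTypeDef.sInter {𝓧 : Set (Set (R.Bar f))} (h : ∀ X ∈ 𝓧, IsTypeDef L (f '' A) X) :
    IsTypeDef L (f '' A) (⋂₀ 𝓧) := by
  refine ⟨{T | (f '' A).Definable L T ∧ ∀ y ∈ ⋂₀ 𝓧, y.1 ∈ T}, fun T hT => hT.1, ?_⟩
  refine Set.Subset.antisymm ?_ fun y hy => ?_
  · rintro _ ⟨y, hy, rfl⟩ T hT
    exact hT.2 y hy
  · have hyC : y ∈ interp f R.carrier :=
      hy _ ⟨definable_interp_carrier R f _, fun y _ => y.2⟩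
    refine ⟨⟨y, hyC⟩, fun X hX => ?_, rfl⟩
    obtain ⟨F, hF, hXF⟩ := h X hX
    rw [← Subtype.val_injective.mem_set_image, hXF]
    refine fun T hT => hy T ⟨hF T hT, fun z hz => ?_⟩
    have : z.1 ∈ Subtype.val '' X := ⟨z, hz X hX, rfl⟩
    rw [hXF] at this
    exact this T hT

theorem IsDef.isTypeDef {X : Set (R.Bar f)} (h : IsDef L (f '' A) X) : IsTypeDef L (f '' A) X :=
  ⟨{Subtype.val '' X}, by
    rintro _ rfl
    exact h, by simp⟩

theorem IsTypeDef.isInv {X : Set (R.Bar f)} (h : IsTypeDef L (f '' A) X) :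
    IsInv L (f '' A) X := by
  obtain ⟨F, hF, hXF⟩ := h
  intro e he x hx
  rw [hXF] at hx ⊢
  intro T hT
  obtain ⟨φ, rfl⟩ := Set.definable_iff_exists_formula_sum.1 (hF T hT)
  have := hx _ hT
  rw [Set.mem_ofPred_eq, ← Language.StrongHomClass.realize_formula e φ] at this
  refine cast (congrArg φ.Realize ?_) this
  funext p
  rcases p with a | j
  · exact he _ a.2
  · rfl

theorem isTypeDef_addComp00 : IsTypeDef L (f '' A) (R.addComp00 f A κ : Set (R.Bar f)) := by
  rw [addComp00, AddSubgroup.coe_sInf]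
  refine (congrArg _ ?_).mp (IsTypeDef.sInter (L := L) (A := A)
    (𝓧 := SetLike.coe '' {H : AddSubgroup (R.Bar f) | IsTypeDef L (f '' A) (H : Set (R.Bar f)) ∧
      #(R.Bar f ⧸ H) < κ}) ?_)
  · rw [Set.sInter_image]
  · rintro _ ⟨H, hH, rfl⟩
    exact hH.1

theorem isTypeDef_addComp0 : IsTypeDef L (f '' A) (R.addComp0 f A : Set (R.Bar f)) := by
  rw [addComp0, AddSubgroup.coe_sInf]
  refine (congrArg _ ?_).mp (IsTypeDef.sInter (L := L) (A := A)
    (𝓧 := SetLike.coe '' {H : AddSubgroup (R.Bar f) | IsDef L (f '' A) (H : Set (R.Bar f)) ∧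
      H.FiniteIndex}) ?_)
  · rw [Set.sInter_image]
  · rintro _ ⟨H, hH, rfl⟩
    exact hH.1.isTypeDef

theorem addComp00_le_addComp0 (hN : IsMonster L N κ) : R.addComp00 f A κ ≤ R.addComp0 f A := by
  refine le_sInf fun H hH => sInf_le ⟨hH.1.isTypeDef, ?_⟩
  have := hH.2
  have : Finite (R.Bar f ⧸ H) := AddSubgroup.finite_quotient_of_finiteIndex
  exact (mk_lt_aleph0 (α := R.Bar f ⧸ H)).trans hN.aleph0_lt

theorem mk_quotient_inf_lt (hN : IsMonster L N κ) {G : Type w'} [AddCommGroup G]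
    {H K : AddSubgroup G} (hH : #(G ⧸ H) < κ) (hK : #(G ⧸ K) < κ) : #(G ⧸ (H ⊓ K)) < κ := by
  refine lt_of_le_of_lt ?_ (mul_lt_of_lt hN.aleph0_lt.le hH hK)
  rw [mul_def]
  refine mk_le_of_injective (f := fun q : G ⧸ (H ⊓ K) =>
    ((QuotientAddGroup.mk q.out : G ⧸ H), (QuotientAddGroup.mk q.out : G ⧸ K))) fun p q hpq => ?_
  rw [Prod.mk.injEq, QuotientAddGroup.eq, QuotientAddGroup.eq] at hpq
  rw [← p.out_eq, ← q.out_eq]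
  exact QuotientAddGroup.eq.2 ⟨hpq.1, hpq.2⟩

/-- A definable set that contains the component contains a type-definable subgroup of bounded
index. -/
theorem exists_subgroup_subset (hN : IsMonster L N κ) (hA : #(f '' A) < κ) {D : Set R.carrier}
    {E : Set (R.Bar f)} (hD : Corr R f A (σ := Unit) (fun g => g () ∈ D) (fun g => g () ∈ E))
    (hE : (R.addComp00 f A κ : Set (R.Bar f)) ⊆ E) : ∃ H : AddSubgroup (R.Bar f),
      IsTypeDef L (f '' A) (H : Set (R.Bar f)) ∧ #(R.Bar f ⧸ H) < κ ∧ (H : Set (R.Bar f)) ⊆ E := by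
  by_contra! hcon
  let 𝓗 : Set (AddSubgroup (R.Bar f)) :=
    {H | IsTypeDef L (f '' A) (H : Set (R.Bar f)) ∧ #(R.Bar f ⧸ H) < κ}
  -- Finitely many members of F contain a common subgroup from 𝓗, which by `hcon` leaves E. A point
  -- outside E in all members of F would lie in every subgroup of 𝓗, hence in the component.
  let F : Set (Set (Fin k → N)) := {T | (f '' A).Definable L T ∧ ∃ H ∈ 𝓗, ∀ y ∈ H, y.1 ∈ T}
  obtain ⟨g, hg⟩ := hN.iInter_nonempty hA (definable_interp_carrier R f ∅) (σ := Unit)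
    (S := fun o : Option F => o.elim {g | ¬ g () ∈ E} fun T => {g | (g ()).1 ∈ T.1})
    (by
      rintro (_ | T)
      · exact DefRel.of_corr' hD.not le_rfl
      · obtain ⟨D, hD⟩ := Corr.exists_of_isDef (isDef_of_definable (R := R) (f := f) T.2.1)
        exact DefRel.of_corr' hD le_rfl)
    (fun t => by
      have : ∀ s : Finset F, ∃ H ∈ 𝓗, ∀ T ∈ s, ∀ y ∈ H, y.1 ∈ T.1 := by
        intro s
        classical
        induction s using Finset.induction_on with
        | empty =>
          refine ⟨⊤, ⟨IsTypeDef.top, ?_⟩, by simp⟩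
          have : Subsingleton (R.Bar f ⧸ (⊤ : AddSubgroup (R.Bar f))) :=
            QuotientAddGroup.subsingleton_quotient_top
          exact (mk_lt_aleph0 (α := R.Bar f ⧸ (⊤ : AddSubgroup (R.Bar f)))).trans hN.aleph0_lt
        | insert T s _ ih =>
          obtain ⟨H, hH, hHs⟩ := ih
          obtain ⟨K, hK, hKT⟩ := T.2.2
          refine ⟨H ⊓ K, ⟨hH.1.inter hK.1, mk_quotient_inf_lt hN hH.2 hK.2⟩, fun T' hT' y hy => ?_⟩
          rcases Finset.mem_insert.1 hT' with rfl | hT'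
          · exact hKT y hy.2
          · exact hHs T' hT' y hy.1
      obtain ⟨H, hH, hHt⟩ := this t.eraseNone
      obtain ⟨y, hy, hyE⟩ := Set.not_subset.1 (hcon H hH.1 hH.2)
      refine ⟨fun _ => y, Set.mem_iInter₂.2 ?_⟩
      rintro (_ | T) hT
      · exact hyE
      · exact hHt T (Finset.mem_eraseNone.2 hT) y hy)
  rw [Set.mem_iInter] at hg
  refine hg none (hE (AddSubgroup.mem_sInf.2 fun H hH => ?_))
  obtain ⟨G, hG, hHG⟩ := hH.1
  rw [← SetLike.mem_coe, ← Subtype.val_injective.mem_set_image, hHG]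
  refine fun T hT => hg (some ⟨T, hG T hT, H, hH, fun y hy => ?_⟩)
  have : y.1 ∈ Subtype.val '' (H : Set (R.Bar f)) := ⟨y, hy, rfl⟩
  rw [hHG] at this
  exact this T hT

/-- The argument passes through a bounded-index subgroup inside E, so bounded index of the component
itself is never needed. -/
theorem isThick_of_addComp00_subset (hN : IsMonster L N κ) (hA : #(f '' A) < κ)
    {D : Set R.carrier} {E : Set (R.Bar f)}
    (hD : Corr R f A (σ := Unit) (fun g => g () ∈ D) (fun g => g () ∈ E))
    (hE : (R.addComp00 f A κ : Set (R.Bar f)) ⊆ E) : IsThick {x | x ∈ D ∧ -x ∈ D} := by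
  obtain ⟨H, hH, hHκ, hHE⟩ := exists_subgroup_subset hN hA hD hE
  obtain ⟨B, hAB, hB, hBH⟩ := exists_sameTypeDiff_subset hN hA hH.isInv hHκ
  exact isThick_of_sameTypeDiff_subset hN hB hAB hD (hBH.trans hHE)

/-- The intersection of all definable sets that contain the differences of elements with the
same type over `B`. -/
def typeDefHull (R : DefinableCommRing L M k) (f : M ↪ₑ[L] N) (A : Set M) (B : Set N) :
    Set (R.Bar f) :=
  {y | ∀ T : Set (Fin k → N), (f '' A).Definable L T → (∀ z ∈ sameTypeDiff R f B, z.1 ∈ T) →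
    y.1 ∈ T}

theorem isTypeDef_typeDefHull {B : Set N} : IsTypeDef L (f '' A) (typeDefHull R f A B) := by
  refine ⟨{T | (f '' A).Definable L T ∧ ∀ z ∈ sameTypeDiff R f B, z.1 ∈ T}, fun T hT => hT.1, ?_⟩
  ext y
  constructor
  · rintro ⟨y, hy, rfl⟩ T hT
    exact hy T hT.1 hT.2
  · intro hy
    exact ⟨⟨y, hy _ ⟨definable_interp_carrier R f _, fun z _ => z.2⟩⟩,
      fun T hT hT' => hy T ⟨hT, hT'⟩, rfl⟩

theorem sameTypeDiff_subset_typeDefHull {B : Set N} :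
    sameTypeDiff R f B ⊆ typeDefHull R f A B :=
  fun y hy _ _ hT => hT y hy

/-- By saturation each x in the hull has the same type over A as some difference -a + b with a, b of
equal type over B. By homogeneity an automorphism over A moves that difference to x, and I is
invariant. -/
theorem typeDefHull_subset (hN : IsMonster L N κ) (hA : #(f '' A) < κ) {B : Set N} (hB : #B < κ)
    (hAB : f '' A ⊆ B) {I : Set (R.Bar f)} (hinv : IsInv L (f '' A) I)
    (hBI : sameTypeDiff R f B ⊆ I) : typeDefHull R f A B ⊆ I := by
  intro x hx
  have hdef : ∀ ψ : L.Formula (f '' A ⊕ Fin k),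
      (f '' A).Definable L {v : Fin k → N | ψ.Realize (Sum.elim Subtype.val v)} := fun ψ =>
    Set.definable_iff_exists_formula_sum.2 ⟨ψ, rfl⟩
  obtain ⟨g, hg⟩ := hN.iInter_nonempty hB (definable_interp_carrier R f ∅) (σ := Fin 2)
    (S := fun o : L.Formula (B ⊕ Fin k) ⊕ {ψ : L.Formula (f '' A ⊕ Fin k) //
        ψ.Realize (Sum.elim Subtype.val x.1)} =>
      o.elim (fun φ => {g | φ.Realize (Sum.elim Subtype.val (g 0).1) ↔
        φ.Realize (Sum.elim Subtype.val (g 1).1)})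
        fun ψ => {g | ψ.1.Realize (Sum.elim Subtype.val (-g 0 + g 1).1)})
    (by
      rintro (φ | ψ)
      · exact DefRel.iff_formula φ 0 1
      · obtain ⟨D, hD⟩ := Corr.exists_of_isDef (isDef_of_definable (R := R) (f := f) (hdef ψ.1))
        exact DefRel.of_corr' (Corr.subst hD
          (fun _ => (CorrTerm.var (0 : Fin 2)).neg.add (CorrTerm.var 1))) hAB)
    (fun t => by
      let Ψ : L.Formula (f '' A ⊕ Fin k) :=
        Language.Formula.iInf fun ψ : t.toRight => ψ.1.1
      have hΨ : ∃ a b : R.Bar f, SameType L B a.1 b.1 ∧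
          Ψ.Realize (Sum.elim Subtype.val (-a + b).1) := by
        -- Otherwise the negation of Ψ defines over A a set that contains all the differences but
        -- not x, against the choice of x in the hull.
        by_contra! hcon
        refine hx _ (hdef Ψ.not) ?_ ?_
        · rintro _ ⟨a, b, hab, rfl⟩
          exact hcon a b hab
        · have : Ψ.Realize (Sum.elim Subtype.val x.1) := by
            rw [Language.Formula.realize_iInf]
            exact fun ψ => ψ.1.2
          exact this
      obtain ⟨a, b, hab, hΨ⟩ := hΨ
      rw [Language.Formula.realize_iInf] at hΨ
      refine ⟨![a, b], Set.mem_iInter₂.2 ?_⟩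
      rintro (φ | ψ) ho
      · exact hab φ
      · exact hΨ ⟨ψ, Finset.mem_toRight.2 ho⟩)
  rw [Set.mem_iInter] at hg
  have hmem : -g 0 + g 1 ∈ I := hBI ⟨g 0, g 1, fun φ => hg (Sum.inl φ), rfl⟩
  have htype : SameType L (f '' A) (-g 0 + g 1).1 x.1 := by
    intro ψ
    refine ⟨fun h => ?_, fun h => hg (Sum.inr ⟨ψ, h⟩)⟩
    by_contra hn
    exact hg (Sum.inr ⟨ψ.not, hn⟩) h
  obtain ⟨e, he, hex⟩ := htype.exists_equiv hN hA
  rw [← Subtype.val_injective.mem_set_image, ← hex]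
  exact hinv e he _ ⟨_, hmem, rfl⟩

theorem nfoldSum_subset {G : Type*} [AddCommGroup G] {X : Set G} {H : AddSubgroup G}
    (h : X ⊆ H) (m : ℕ) : nfoldSum m X ⊆ H := by
  rintro _ ⟨s, hs, rfl⟩
  exact sum_mem fun i _ => h (hs i)

theorem nfoldSum_mono {G : Type*} [AddCommMonoid G] {X Y : Set G} (h : X ⊆ Y) (m : ℕ) :
    nfoldSum m X ⊆ nfoldSum m Y := by
  rintro _ ⟨s, hs, rfl⟩
  exact ⟨s, fun i => h (hs i), rfl⟩

theorem Side.mulSet_eq_left {T : Type*} [CommRing T] (i : Side) (D : Set T) :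
    i.mulSet D = Side.left.mulSet D := by
  ext x
  cases i with
  | left => rfl
  | right =>
    constructor
    · rintro ⟨d, hd, r, rfl⟩
      exact ⟨r, d, hd, mul_comm _ _⟩
    · rintro ⟨r, d, hd, rfl⟩
      exact ⟨d, hd, r, mul_comm _ _⟩
  | both =>
    constructor
    · rintro ⟨r, d, hd, s, rfl⟩
      exact ⟨r * s, d, hd, by ring⟩
    · rintro ⟨r, d, hd, rfl⟩
      exact ⟨r, d, hd, 1, by ring⟩

theorem mulSet_left_subset {T : Type*} [CommRing T] {D : Set T} {I : Ideal T} (h : D ⊆ I) :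
    Side.left.mulSet D ⊆ I := by
  rintro _ ⟨r, d, hd, rfl⟩
  exact I.mul_mem_left r (h hd)

theorem mulSet_left_mono {T : Type*} [CommRing T] {D E : Set T} (h : D ⊆ E) :
    Side.left.mulSet D ⊆ Side.left.mulSet E := by
  rintro _ ⟨r, d, hd, rfl⟩
  exact ⟨r, d, h hd, rfl⟩

theorem isThick_of_finiteIndex {G : Type*} [AddGroup G] (H : AddSubgroup G) (hH : H.FiniteIndex) :
    IsThick (H : Set G) := by
  have : Finite (G ⧸ H) := AddSubgroup.finite_quotient_of_finiteIndex
  have := Fintype.ofFinite (G ⧸ H)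
  refine ⟨fun x hx => H.neg_mem hx, Fintype.card (G ⧸ H) + 1, Nat.succ_pos _, fun g => ?_⟩
  obtain ⟨i, j, hij, h⟩ := Fintype.exists_ne_map_eq_of_card_lt
    (fun i => (QuotientAddGroup.mk (g i) : G ⧸ H)) (by simp)
  rcases lt_or_gt_of_ne hij with hlt | hlt
  · exact ⟨i, j, hlt, QuotientAddGroup.eq.1 h⟩
  · exact ⟨j, i, hlt, QuotientAddGroup.eq.1 h.symm⟩

theorem mk_image_lt (hA : Cardinal.lift.{w'} #A < Cardinal.lift.{w} κ) : #(f '' A) < κ :=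
  lift_lt.1 (mk_image_le_lift.trans_lt hA)

theorem addComp0_subset_comp0 : (R.addComp0 f A : Set (R.Bar f)) ⊆ R.comp0 f A := fun _ hx =>
  Ideal.mem_sInf.2 fun {I} hI => AddSubgroup.mem_sInf.1 hx I.toAddSubgroup
    ⟨hI.1, have : Finite (R.Bar f ⧸ I.toAddSubgroup) := hI.2
      AddSubgroup.finiteIndex_of_finite_quotient⟩

section Conditions

variable {m : ℕ} {S : Set R.carrier} (hSA : ∀ s ∈ S, ∀ j : Fin k, s.1 j ∈ A)
  (hgen : Subring.closure S = ⊤)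
  (hgenThick : ∀ D : Set R.carrier, IsThick D → ∃ d : Fin m → R.carrier, (∀ i, d i ∈ D) ∧
      Finite (R.carrier ⧸ Ideal.span (Set.range d)))
include hSA hgen hgenThick

theorem containsIdeal_of_isThick (f : M ↪ₑ[L] N) {D : Set R.carrier} (hD : IsThick D) :
    R.ContainsIdeal A (nfoldSum m (Side.left.mulSet D)) := by
  obtain ⟨d, hd, hfin⟩ := hgenThick D hD
  refine ⟨_, isDef_span hSA hgen f d, hfin, fun x hx => ?_⟩
  obtain ⟨r, hr⟩ := Ideal.mem_span_range_iff_exists_fun.1 hx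
  exact ⟨fun i => r i * d i, fun i => ⟨_, _, hd i, rfl⟩, hr.symm⟩

theorem condIII (f : M ↪ₑ[L] N) (i : Side) : R.CondIII A i m := by
  intro H _ hH
  rw [Side.mulSet_eq_left]
  exact containsIdeal_of_isThick hSA hgen hgenThick f (isThick_of_finiteIndex H hH)

variable (hN : IsMonster L N κ) (hA : #(f '' A) < κ)
include hN hA

/-- An invariant ideal need not be type-definable, so compactness is applied to the hull of the
same-type differences, which lies inside I. -/
theorem comp0_le_of_isInv {I : Ideal (R.Bar f)} (hinv : IsInv L (f '' A) (I : Set (R.Bar f)))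
    (hI : #(R.Bar f ⧸ I) < κ) : R.comp0 f A ≤ I := by
  obtain ⟨B, hAB, hB, hBI⟩ := exists_sameTypeDiff_subset hN hA (H := I.toAddSubgroup) hinv hI
  refine (comp0_subset_nfoldSum hN hA hSA hgen hgenThick (isTypeDef_typeDefHull (B := B))
    fun D E hDE hE => isThick_of_sameTypeDiff_subset hN hB hAB hDE
      (sameTypeDiff_subset_typeDefHull.trans hE)).trans ?_
  exact nfoldSum_subset (H := I.toAddSubgroup)
    (mulSet_left_subset (typeDefHull_subset hN hA hB hAB hinv hBI)) m

theorem comp0_subset_of_addComp00_subset {Y : Set (R.Bar f)} (hY : IsTypeDef L (f '' A) Y)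
    (h : (R.addComp00 f A κ : Set (R.Bar f)) ⊆ Y) :
    (R.comp0 f A : Set (R.Bar f)) ⊆ nfoldSum m (Side.left.mulSet Y) :=
  comp0_subset_nfoldSum hN hA hSA hgen hgenThick hY fun _ _ hDE hE =>
    isThick_of_addComp00_subset hN hA hDE (h.trans hE)

/-- A cycle of inclusions: `comp0` ⊆ `comp000` ⊆ `comp00` ⊆ `comp0` ⊆ m-fold sum ⊆ generated
subgroup ⊆ `comp00`. Hence all of them are equal. -/
theorem condI (i : Side) : R.CondI f A κ i m := by
  unfold CondI
  rw [Side.mulSet_eq_left]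
  have h1 := comp0_subset_of_addComp00_subset hSA hgen hgenThick hN hA
    (isTypeDef_addComp00 (κ := κ)) le_rfl
  have h2 : (R.comp00 f A κ : Set (R.Bar f)) ⊆ R.comp0 f A := by
    refine SetLike.coe_subset_coe.2 (le_sInf fun I hI => sInf_le ⟨hI.1.isTypeDef, ?_⟩)
    have := hI.2
    exact (mk_lt_aleph0 (α := R.Bar f ⧸ I)).trans hN.aleph0_lt
  have h3 : (R.comp000 f A κ : Set (R.Bar f)) ⊆ R.comp00 f A κ :=
    SetLike.coe_subset_coe.2 (sInf_le_sInf fun I hI => ⟨hI.1.isInv, hI.2⟩)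
  have h4 : (R.comp0 f A : Set (R.Bar f)) ⊆ R.comp000 f A κ :=
    SetLike.coe_subset_coe.2 (le_sInf fun I hI =>
      comp0_le_of_isInv hSA hgen hgenThick hN hA hI.1 hI.2)
  have h5 : (R.addComp00 f A κ : Set (R.Bar f)) ⊆ R.comp00 f A κ := fun x hx =>
    Ideal.mem_sInf.2 fun {I} hI => AddSubgroup.mem_sInf.1 hx I.toAddSubgroup ⟨hI.1, hI.2⟩
  have h6 : (AddSubgroup.closure (Side.left.mulSet (R.addComp00 f A κ : Set (R.Bar f))) :
      Set (R.Bar f)) ⊆ R.comp00 f A κ :=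
    (AddSubgroup.closure_le (R.comp00 f A κ).toAddSubgroup).2 (mulSet_left_subset h5)
  have h7 := nfoldSum_subset (AddSubgroup.subset_closure
    (k := Side.left.mulSet (R.addComp00 f A κ : Set (R.Bar f)))) m
  exact ⟨(h6.trans (h2.trans h1)).antisymm h7,
    (h3.trans (h2.trans h1)).antisymm (h7.trans (h6.trans (h2.trans h4))),
    (h2.trans h1).antisymm (h7.trans h6)⟩

theorem condII (i : Side) : R.CondII f A κ i m := by
  intro D hD hX
  rw [Side.mulSet_eq_left]
  obtain ⟨I, hI, hfin, hle⟩ := containsIdeal_of_isThick hSA hgen hgenThick f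
    (isThick_of_addComp00_subset hN hA (Corr.mem hD ()) hX)
  exact ⟨I, hI, hfin, hle.trans (nfoldSum_mono (mulSet_left_mono fun x hx => hx.1) m)⟩

/-- A shorter cycle: `comp0` ⊆ m-fold sum ⊆ generated subgroup ⊆ `comp0`. The first inclusion
applies because `addComp0` is type-definable and contains `addComp00`. -/
theorem condIV_and_condV (i : Side) : R.CondIV f A i m ∧ R.CondV f A i m := by
  unfold CondIV CondV
  rw [Side.mulSet_eq_left]
  have h1 := comp0_subset_of_addComp00_subset hSA hgen hgenThick hN hA isTypeDef_addComp0
    (addComp00_le_addComp0 hN)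
  have h2 : (AddSubgroup.closure (Side.left.mulSet (R.addComp0 f A : Set (R.Bar f))) :
      Set (R.Bar f)) ⊆ R.comp0 f A :=
    (AddSubgroup.closure_le (R.comp0 f A).toAddSubgroup).2
      (mulSet_left_subset addComp0_subset_comp0)
  have h3 := nfoldSum_subset (AddSubgroup.subset_closure
    (k := Side.left.mulSet (R.addComp0 f A : Set (R.Bar f)))) m
  exact ⟨(h2.trans h1).antisymm h3, (h3.trans h2).antisymm h1⟩

end Conditions

end MainArgument

end ModelRing

theorem mainTheorem11 {L : FirstOrder.Language.{u, v}} {M : Type w} {N : Type w'}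
    [L.Structure M] [L.Structure N] [Nonempty M]
    (f : M ↪ₑ[L] N) (κ : Cardinal.{w'}) (hN : ModelRing.IsMonster L N κ)
    (A : Set M) (hA : Cardinal.lift.{w'} #A < Cardinal.lift.{w} κ)
    (k : ℕ) (R : ModelRing.DefinableCommRing L M k)
    (n : ℕ) (S : Finset R.carrier) (hcard : S.card = n)
    (hSA : ∀ s ∈ S, ∀ j : Fin k, s.1 j ∈ A)
    (hgen : Subring.closure (S : Set R.carrier) = ⊤) :
    ((∀ D : Set R.carrier, ModelRing.IsThick D →
        R.ContainsIdeal A (ModelRing.nfoldSum (n + 1) (ModelRing.Side.left.mulSet D))) ∧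
      ∀ i : ModelRing.Side, R.CondI f A κ i (n + 1) ∧ R.CondII f A κ i (n + 1) ∧
        R.CondIII A i (n + 1) ∧ R.CondIV f A i (n + 1) ∧ R.CondV f A i (n + 1)) ∧
    (0 < ringChar R.carrier →
      (∀ D : Set R.carrier, ModelRing.IsThick D →
        R.ContainsIdeal A (ModelRing.nfoldSum n (ModelRing.Side.left.mulSet D))) ∧
      ∀ i : ModelRing.Side, R.CondI f A κ i n ∧ R.CondII f A κ i n ∧
        R.CondIII A i n ∧ R.CondIV f A i n ∧ R.CondV f A i n) := by
  have hA' : #(f '' A) < κ := ModelRing.mk_image_lt hA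
  have main : ∀ m : ℕ, (∀ D : Set R.carrier, ModelRing.IsThick D → ∃ d : Fin m → R.carrier,
      (∀ i, d i ∈ D) ∧ Finite (R.carrier ⧸ Ideal.span (Set.range d))) →
      (∀ D : Set R.carrier, ModelRing.IsThick D →
        R.ContainsIdeal A (ModelRing.nfoldSum m (ModelRing.Side.left.mulSet D))) ∧
      ∀ i : ModelRing.Side, R.CondI f A κ i m ∧ R.CondII f A κ i m ∧
        R.CondIII A i m ∧ R.CondIV f A i m ∧ R.CondV f A i m := fun m hm =>
    ⟨fun D hD => ModelRing.containsIdeal_of_isThick hSA hgen hm f hD, fun i =>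
      ⟨ModelRing.condI hSA hgen hm hN hA' i, ModelRing.condII hSA hgen hm hN hA' i,
        ModelRing.condIII hSA hgen hm f i, ModelRing.condIV_and_condV hSA hgen hm hN hA' i⟩⟩
  subst hcard
  exact ⟨main _ fun D hD => hD.exists_fin_succ hgen,
    fun hchar => main _ fun D hD => hD.exists_fin hgen hchar⟩
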